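/- Let $N,K\ge 1$, let $\pi_1,\dots,\pi_K>0$ with $\sum_c\pi_c=1$, and let $\mathbf R_1,\dots,\mathbf R_K$ be positive semidefinite Hermitian $N\times N$ matrices, $\mathbf R_c$ having eigenvalues $\lambda_{c,1},\dots,\lambda_{c,N}\ge 0$. Let $C$ be a random state with $\Pr(C=c)=\pi_c$, and let $\mathbf h\in\mathbb C^N$ be proper complex Gaussian given the state, $\mathbf h\mid\{C=c\}\sim\mathcal{CN}(\mathbf 0,\mathbf R_c)$, so that $\mathbf h$ has the Gaussian-mixture law $\sum_c\pi_c\,\mathcal{CN}(\mathbf 0,\mathbf R_c)$. Consider i.i.d. copies $(C_t,\mathbf h_t)_{t\ge1}$. Distortion is mean squared error per complex dimension and rates are in bits per complex dimension. For $D\ge0$ let $R^\star(D)\in[0,\infty]$ be the rate-distortion function of $\mathbf h$: the infimum of the rates $R\ge0$ for which there are encoders $f_n:(\mathbb C^N)^n\to\{1,\dots,\lfloor 2^{nNR}\rfloor\}$ and decoders $g_n$ such that the reconstruction $\hat{\mathbf h}^n=g_n(f_n(\mathbf h^n))$ satisfies $\limsup_n\mathbb E\big[\frac1{nN}\sum_{t=1}^n\|\mathbf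 h_t-\hat{\mathbf h}_t\|_2^2\big]\le D$. Let $R_{\mathbf h|C}(D)$ be defined in the same way when the state sequence $C^n=(C_1,\dots,C_n)$ is available at no rate cost to both the encoder and the decoder. For each state $c$ let $R_c$ be the reverse-waterfilling function $$R_c(D_c)=\frac1N\sum_{m=1}^N\Big[\log_2\frac{\lambda_{c,m}}{\mu_c}\Big]_+,\qquad D_c=\frac1N\sum_{m=1}^N\min\{\lambda_{c,m},\mu_c\},\quad \mu_c\ge0,$$ with $R_c(D_c)=0$ for $D_c\ge\frac1N\sum_m\lambda_{c,m}$ (for $\mu_c=0$ a mode contributes $+\infty$ to the rate if $\lambda_{c,m}>0$ and $0$ if $\lambda_{c,m}=0$), and put $$R_{\rm cond}(D)=\min_{\{D_c\ge0\}:\ \sum_c\pi_cD_c\le D}\ \sum_{c=1}^K\pi_cR_c(D_c).$$ Then, for every $D\ge0$, this minimum is attained, and $$R_{\mathbf h|C}(D)=R_{\rm cond}(D),\qquad R^\star(D)\ge R_{\rm cond}(D).$$ Both relations hold likewise for the single-letter forms of the two rate-distortion functions: $$\frac1N\inf_{p(\hat{\mathbf h}\mid\mathbf h,C):\ \frac1N\mathbb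 E\|\mathbf h-\hat{\mathbf h}\|_2^2\le D}I(\mathbf h;\hat{\mathbf h}\mid C)=R_{\rm cond}(D),\qquad \frac1N\inf_{p(\hat{\mathbf h}\mid\mathbf h):\ \frac1N\mathbb E\|\mathbf h-\hat{\mathbf h}\|_2^2\le D}I(\mathbf h;\hat{\mathbf h})\ge R_{\rm cond}(D).$$ -/

import Mathlib

open MeasureTheory ProbabilityTheory InformationTheory Filter
open scoped NNReal ENNReal ComplexOrder

noncomputable section

namespace CSI

/-- Complex vectors of dimension `N`, with the Euclidean norm. -/
abbrev Vec (N : ℕ) : Type := EuclideanSpace ℂ (Fin N)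

/-! ### The Gaussian-mixture source -/

/-- The scalar proper complex Gaussian law `CN(0, v)`: real and imaginary parts are independent
centred real Gaussians of variance `v / 2`. -/
def complexGaussian (v : ℝ≥0) : Measure ℂ :=
  ((gaussianReal 0 (v / 2)).prod (gaussianReal 0 (v / 2))).map Complex.measurableEquivRealProd.symm

/-- The eigenvalues of a positive semidefinite matrix, with multiplicity. -/
def spectrumOf {N : ℕ} {R : Matrix (Fin N) (Fin N) ℂ} (hR : R.PosSemidef) (m : Fin N) : ℝ≥0 :=
  ⟨hR.isHermitian.eigenvalues m, hR.eigenvalues_nonneg m⟩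

/-- The proper complex Gaussian law `CN(0, R)` on `ℂ^N`: with `R = U Λ Uᴴ`, it is the law of `U x`,
where the coordinates `x_m ∼ CN(0, λ_m)` are independent. Singular `R` is allowed. -/
def complexGaussianVec {N : ℕ} {R : Matrix (Fin N) (Fin N) ℂ} (hR : R.PosSemidef) :
    Measure (Vec N) :=
  (Measure.pi fun m => complexGaussian (spectrumOf hR m)).map fun x =>
    WithLp.toLp 2
      ((hR.isHermitian.eigenvectorUnitary : Matrix (Fin N) (Fin N) ℂ).mulVec x)

/-- Parameters of a zero-mean proper complex Gaussian mixture on `ℂ^N` with `K` components. -/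
structure GaussianMixture (N K : ℕ) where
  /-- the probability of each state -/
  weight : Fin K → ℝ≥0
  weight_pos : ∀ c, 0 < weight c
  weight_sum : ∑ c, weight c = 1
  /-- the covariance matrix of each state -/
  cov : Fin K → Matrix (Fin N) (Fin N) ℂ
  cov_posSemidef : ∀ c, (cov c).PosSemidef

namespace GaussianMixture

variable {N K : ℕ} (S : GaussianMixture N K)

/-- The conditional law of the source vector given the state `c`. -/
def component (c : Fin K) : Measure (Vec N) := complexGaussianVec (S.cov_posSemidef c)

/-- The joint law of the state and the source vector `(C, h)`. -/
def jointLaw : Measure (Fin K × Vec N) :=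
  ∑ c, (S.weight c : ℝ≥0∞) • (Measure.dirac c).prod (S.component c)

/-- The mixture law of the source vector `h`. -/
def law : Measure (Vec N) := ∑ c, (S.weight c : ℝ≥0∞) • S.component c

end GaussianMixture

/-! ### Operational rate-distortion functions

All rates are in bits per complex dimension. -/

/-- The number of messages `⌊2^{nNR}⌋` of a rate-`R` code of blocklength `n`. -/
def numMessages (N n : ℕ) (R : ℝ≥0) : ℕ := ⌊(2 : ℝ) ^ ((n : ℝ) * N * R)⌋₊

/-- The squared error per complex dimension `(1 / (nN)) ∑ₜ ‖xₜ - yₜ‖²` of a block. -/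
def blockError {N n : ℕ} (x y : Fin n → Vec N) : ℝ≥0∞ :=
  (∑ t, ‖x t - y t‖ₑ ^ 2) / ((n : ℝ≥0∞) * N)

/-- `(R, D)` is achievable for the memoryless source with single-letter law `μ`: there are rate-`R`
codes, one for each blocklength `n`, with asymptotic expected distortion at most `D`. -/
def Achievable {N : ℕ} (μ : Measure (Vec N)) (R D : ℝ≥0) : Prop :=
  ∃ (f : ∀ n, (Fin n → Vec N) → Fin (numMessages N n R))
    (g : ∀ n, Fin (numMessages N n R) → (Fin n → Vec N)),
    (∀ n, Measurable (f n)) ∧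
      limsup (fun n => ∫⁻ x, blockError x (g n (f n x)) ∂(Measure.pi fun _ : Fin n => μ)) atTop
        ≤ (D : ℝ≥0∞)

/-- The rate-distortion function: the least rate that achieves distortion `D`. -/
def rdFunction {N : ℕ} (μ : Measure (Vec N)) (D : ℝ≥0) : ℝ≥0∞ :=
  ⨅ (R : ℝ≥0) (_ : Achievable μ R D), (R : ℝ≥0∞)

/-- `(R, D)` is achievable for the memoryless source `(C, h)` with single-letter law `μ` when the
state sequence `C^n` is available at no cost to both the encoder and the decoder and only `h^n` has
to be reproduced. -/
def AchievableWithState {N K : ℕ} (μ : Measure (Fin K × Vec N)) (R D : ℝ≥0) : Prop :=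
  ∃ (f : ∀ n, (Fin n → Fin K × Vec N) → Fin (numMessages N n R))
    (g : ∀ n, Fin (numMessages N n R) → (Fin n → Fin K) → (Fin n → Vec N)),
    (∀ n, Measurable (f n)) ∧
      limsup (fun n => ∫⁻ z, blockError (fun t => (z t).2) (g n (f n z) fun t => (z t).1)
        ∂(Measure.pi fun _ : Fin n => μ)) atTop ≤ (D : ℝ≥0∞)

/-- The conditional rate-distortion function: the least rate that achieves distortion `D` when the
state is revealed to both terminals. -/
def condRDFunction {N K : ℕ} (μ : Measure (Fin K × Vec N)) (D : ℝ≥0) : ℝ≥0∞ :=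
  ⨅ (R : ℝ≥0) (_ : AchievableWithState μ R D), (R : ℝ≥0∞)

/-! ### Single-letter (information) rate-distortion functions -/

/-- Mutual information, in bits, of a pair with joint law `ρ`. -/
def mutualInfo {α β : Type*} [MeasurableSpace α] [MeasurableSpace β] (ρ : Measure (α × β)) :
    ℝ≥0∞ :=
  klDiv ρ (ρ.fst.prod ρ.snd) / ENNReal.ofReal (Real.log 2)

/-- Conditional mutual information `I(X; Y | C) = ∑_c P(C = c) I(X; Y | C = c)`, in bits, where
`((C, X), Y)` has the law `ρ`. -/
def condMutualInfo {K : ℕ} {α β : Type*} [MeasurableSpace α] [MeasurableSpace β]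
    (ρ : Measure ((Fin K × α) × β)) : ℝ≥0∞ :=
  ∑ c, ρ {z | z.1.1 = c} * mutualInfo ((ρ[|{z | z.1.1 = c}]).map fun z => (z.1.2, z.2))

/-- `(1/N) inf I(h; ĥ)` over the test channels `p(ĥ | h)` with `(1/N) E‖h - ĥ‖² ≤ D`. -/
def infoRD {N : ℕ} (μ : Measure (Vec N)) (D : ℝ≥0) : ℝ≥0∞ :=
  ⨅ (κ : Kernel (Vec N) (Vec N)) (_ : IsMarkovKernel κ)
    (_ : (N : ℝ≥0∞)⁻¹ * ∫⁻ z, ‖z.1 - z.2‖ₑ ^ 2 ∂(μ ⊗ₘ κ) ≤ D),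
    (N : ℝ≥0∞)⁻¹ * mutualInfo (μ ⊗ₘ κ)

/-- `(1/N) inf I(h; ĥ | C)` over the test channels `p(ĥ | h, C)` with `(1/N) E‖h - ĥ‖² ≤ D`. -/
def condInfoRD {N K : ℕ} (μ : Measure (Fin K × Vec N)) (D : ℝ≥0) : ℝ≥0∞ :=
  ⨅ (κ : Kernel (Fin K × Vec N) (Vec N)) (_ : IsMarkovKernel κ)
    (_ : (N : ℝ≥0∞)⁻¹ * ∫⁻ z, ‖z.1.2 - z.2‖ₑ ^ 2 ∂(μ ⊗ₘ κ) ≤ D),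
    (N : ℝ≥0∞)⁻¹ * condMutualInfo (μ ⊗ₘ κ)

/-! ### Reverse waterfilling and the conditional benchmark -/

/-- `[log₂ (v / μ)]₊` for `v, μ ≥ 0`, with the value `∞` for `μ = 0 < v`, and `0` for `v = 0`. -/
def modeRate (v μ : ℝ≥0) : ℝ≥0∞ :=
  (ENNReal.log ((v : ℝ≥0∞) / (μ : ℝ≥0∞))).toENNReal / ENNReal.ofReal (Real.log 2)

/-- The rate `(1/N) ∑ₘ [log₂ (vₘ / μ)]₊` at water level `μ`. -/
def waterRate {N : ℕ} (v : Fin N → ℝ≥0) (μ : ℝ≥0) : ℝ≥0∞ :=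
  (∑ m, modeRate (v m) μ) / (N : ℝ≥0∞)

/-- The distortion `(1/N) ∑ₘ min {vₘ, μ}` at water level `μ`. -/
def waterDistortion {N : ℕ} (v : Fin N → ℝ≥0) (μ : ℝ≥0) : ℝ≥0 :=
  (∑ m, min (v m) μ) / (N : ℝ≥0)

/-- The parametric reverse-waterfilling function of a spectrum `v`: the rate at a water level `μ`
whose distortion is `D`. Above the largest attainable distortion, the mean of `v`, it is constant
(and zero). The water level is unique below the mean, and the rate is zero at each
water level that attains the mean, so the infimum merely selects the common value. -/
def waterfillingRD {N : ℕ} (v : Fin N → ℝ≥0) (D : ℝ≥0) : ℝ≥0∞ :=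
  ⨅ (μ : ℝ≥0) (_ : waterDistortion v μ = min D ((∑ m, v m) / (N : ℝ≥0))), waterRate v μ

namespace GaussianMixture

variable {N K : ℕ} (S : GaussianMixture N K)

/-- The function `R_c` of state `c`. -/
def componentRD (c : Fin K) (D : ℝ≥0) : ℝ≥0∞ :=
  waterfillingRD (spectrumOf (S.cov_posSemidef c)) D

/-- The average rate `∑_c π_c R_c(D_c)` of a distortion allocation `(D_c)`. -/
def allocationRate (d : Fin K → ℝ≥0) : ℝ≥0∞ :=
  ∑ c, (S.weight c : ℝ≥0∞) * S.componentRD c (d c)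

/-- The conditional benchmark `R_cond(D)`: the least value of `∑_c π_c R_c(D_c)` over the
allocations with `∑_c π_c D_c ≤ D`. -/
def Rcond (D : ℝ≥0) : ℝ≥0∞ :=
  ⨅ (d : Fin K → ℝ≥0) (_ : ∑ c, S.weight c * d c ≤ D), S.allocationRate d

end GaussianMixture

end CSI

end

noncomputable section

namespace CSI

/-! ### Reverse waterfilling -/

/-! The proof is Lagrangian duality at one water level θ common to all states. At slope 1/θ, rate
plus distortion/θ of a mode is smallest at the water level θ itself; this is log x ≤ x − 1
(`lag_le`). Averaging over modes and states gives, for every θ > 0, a dual lower bound on the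
benchmark. The average distortion is continuous in θ and vanishes at θ = 0. Hence either some
positive level is feasible and exhausts the budget or needs no rate, and there the rate and the dual
bound meet; or D = 0 with a nondegenerate mode, and the dual bounds are unbounded (`exists_level`).
So whatever dominates all dual bounds dominates `Rcond` (`Rcond_le_of_forall`), and whatever lies
below the rate of each feasible level lies below `Rcond` (`le_Rcond_of_forall`). The remaining
claims are then treated at a fixed θ.

`MatchedPair` carries this duality to laws. The inequality ∫ exp(A − q(·, y)) dμ ≤ 1 for all y is a
certificate for lower bounds; the coupling of density exp(A − q) is the test channel attaining them,
with information E A − E q. For a real Gaussian it is the backward channel x = y + w. Products, a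
unitary rotation and mixing over the states carry it to the source (C, h) with cost ‖h − ĥ‖²/θ.

Lower bounds: Donsker–Varadhan with A − q gives the information bound, state by state when C is
known. For the mixture law the potentials are averaged with the posterior probabilities of the
states; convexity of exp keeps the average feasible, and its mean is unchanged
(`exists_mixture_potential`). For codes with M messages, exp of the sum of A − q over the block has
mean at most M, so Jensen bounds log M from below (`le_log_of_code`). A code that ignores the state
is a code with state, which gives the bound on the operational function of the mixture.

Upper bounds: the kernels of the couplings are feasible test channels. For codes, a random codebook
covers the source (`exists_codebook`), the square integrability in `MatchedPair` gives a weak law by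
Chebyshev, and a fixed reference word controls the unbounded distortion on the exceptional set. -/

/-- The rate, in nats, of a mode of variance `v` at water level `θ > 0`. -/
def gain (v θ : ℝ≥0) : ℝ := Real.log (max (v : ℝ) θ / θ)

/-- The Lagrangian of a mode of variance `v` at the slope `1 / θ`. -/
def lag (v θ : ℝ≥0) : ℝ := gain v θ + min (v : ℝ) θ / θ

lemma gain_nonneg (v : ℝ≥0) {θ : ℝ≥0} (hθ : 0 < θ) : 0 ≤ gain v θ := by
  have : (0 : ℝ) < θ := hθ
  exact Real.log_nonneg (by rw [le_div_iff₀ this]; simp)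

lemma lag_nonneg (v : ℝ≥0) {θ : ℝ≥0} (hθ : 0 < θ) : 0 ≤ lag v θ :=
  add_nonneg (gain_nonneg v hθ) (by positivity)

lemma gain_eq_zero {v θ : ℝ≥0} (hθ : 0 < θ) (h : v ≤ θ) : gain v θ = 0 := by
  have : (0 : ℝ) < θ := hθ
  have h' : (v : ℝ) ≤ θ := h
  simp [gain, max_eq_right h', div_self this.ne']

lemma modeRate_eq (v : ℝ≥0) {θ : ℝ≥0} (hθ : 0 < θ) :
    modeRate v θ = ENNReal.ofReal (gain v θ) / ENNReal.ofReal (Real.log 2) := by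
  unfold modeRate
  congr 1
  rcases le_total v θ with h | h
  · rw [gain_eq_zero hθ h, ENNReal.ofReal_zero, EReal.toENNReal_eq_zero_iff]
    rw [← ENNReal.log_one]
    apply ENNReal.log_monotone
    exact ENNReal.div_le_of_le_mul (by simpa using h)
  · have hθ' : (0 : ℝ) < θ := hθ
    have h' : (θ : ℝ) ≤ v := h
    have : ((v : ℝ≥0∞) / (θ : ℝ≥0∞)) = ENNReal.ofReal ((v : ℝ) / θ) := by
      rw [ENNReal.ofReal_div_of_pos hθ']; simp
    rw [this, ENNReal.log_ofReal_of_pos (div_pos (hθ'.trans_le h') hθ'), gain, max_eq_left h']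
    simp

lemma modeRate_zero {v : ℝ≥0} (hv : 0 < v) : modeRate v 0 = ∞ := by
  unfold modeRate
  rw [ENNReal.coe_zero, ENNReal.div_zero (by simpa using hv.ne'), ENNReal.log_top,
    EReal.toENNReal_top]
  exact ENNReal.top_div_of_ne_top ENNReal.ofReal_ne_top

lemma waterRate_eq {N : ℕ} (hN : 0 < N) (v : Fin N → ℝ≥0) {θ : ℝ≥0} (hθ : 0 < θ) :
    waterRate v θ = ENNReal.ofReal ((∑ m, gain (v m) θ) / (N * Real.log 2)) := by
  have hN' : (0 : ℝ) < N := by exact_mod_cast hN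
  have h2 : 0 < Real.log 2 := Real.log_pos one_lt_two
  simp only [waterRate, modeRate_eq _ hθ, div_eq_mul_inv]
  rw [← Finset.sum_mul, ← ENNReal.ofReal_sum_of_nonneg fun _ _ => gain_nonneg _ hθ]
  rw [← div_eq_mul_inv, ← div_eq_mul_inv, ← div_eq_mul_inv, ← ENNReal.ofReal_div_of_pos h2,
    ← ENNReal.ofReal_natCast, ← ENNReal.ofReal_div_of_pos hN', div_div, mul_comm (N : ℝ)]

/-- Optimality of the level θ against the slope 1/θ. If v is below both levels there is nothing to
prove; every other ordering of v, θ, μ reduces to the tangent bound log x ≤ x − 1. -/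
lemma lag_le (v : ℝ≥0) {μ θ : ℝ≥0} (hμ : 0 < μ) (hθ : 0 < θ) :
    lag v θ ≤ gain v μ + min (v : ℝ) μ / θ := by
  have hμ' : (0 : ℝ) < μ := hμ
  have hθ' : (0 : ℝ) < θ := hθ
  have hv : (0 : ℝ) ≤ v := v.2
  unfold lag gain
  have key : ∀ a b : ℝ, 0 < a → 0 < b → Real.log b - Real.log a ≤ b / a - 1 := by
    intro a b ha hb
    rw [← Real.log_div hb.ne' ha.ne']
    exact Real.log_le_sub_one_of_pos (div_pos hb ha)
  rcases le_total (v : ℝ) θ with h1 | h1 <;> rcases le_total (v : ℝ) μ with h2 | h2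
  · simp [h1, h2, hμ'.ne', hθ'.ne']
  · rw [max_eq_right h1, min_eq_left h1, max_eq_left h2, min_eq_right h2, div_self hθ'.ne',
      Real.log_one, Real.log_div (hμ'.trans_le h2).ne' hμ'.ne']
    have := key v μ (hμ'.trans_le h2) hμ'
    have h3 : ((v : ℝ) - μ) / θ ≤ (v - μ) / v :=
      div_le_div_of_nonneg_left (by linarith) (hμ'.trans_le h2) h1
    have h4 : ((v : ℝ) - μ) / v = 1 - μ / v := by
      rw [sub_div, div_self (hμ'.trans_le h2).ne']
    rw [sub_div] at h3
    linarith
  · rw [max_eq_left h1, min_eq_right h1, max_eq_right h2, min_eq_left h2, div_self hμ'.ne',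
      Real.log_one, Real.log_div (hθ'.trans_le h1).ne' hθ'.ne', div_self hθ'.ne']
    have := key θ v hθ' (hθ'.trans_le h1)
    linarith
  · rw [max_eq_left h1, min_eq_right h1, max_eq_left h2, min_eq_right h2,
      Real.log_div (hθ'.trans_le h1).ne' hθ'.ne', Real.log_div (hμ'.trans_le h2).ne' hμ'.ne',
      div_self hθ'.ne']
    have := key θ μ hθ' hμ'
    linarith

lemma waterDistortion_coe {N : ℕ} (v : Fin N → ℝ≥0) (θ : ℝ≥0) :
    (waterDistortion v θ : ℝ) = (∑ m, min (v m : ℝ) θ) / N := by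
  simp [waterDistortion]

/-- Weak duality for one spectrum: each level μ in the infimum has distortion at most D, and
`lag_le` applies mode by mode. -/
lemma waterfillingRD_lower {N : ℕ} (hN : 0 < N) (v : Fin N → ℝ≥0) {θ : ℝ≥0} (hθ : 0 < θ)
    (D : ℝ≥0) :
    ENNReal.ofReal ((∑ m, lag (v m) θ - N * D / θ) / (N * Real.log 2)) ≤ waterfillingRD v D := by
  have hN' : (0 : ℝ) < N := by exact_mod_cast hN
  have hθ' : (0 : ℝ) < θ := hθ
  have h2 : 0 < Real.log 2 := Real.log_pos one_lt_two
  refine le_iInf₂ fun μ hμ => ?_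
  have hle : (∑ m, min (v m : ℝ) μ) ≤ N * D := by
    have : (waterDistortion v μ : ℝ) ≤ D := by rw [hμ]; exact_mod_cast min_le_left _ _
    rw [waterDistortion_coe, div_le_iff₀ hN'] at this
    linarith
  -- At level 0 the rate is infinite unless every mode vanishes, and then the left side is
  -- nonpositive.
  rcases eq_or_ne μ 0 with h0 | h0
  · subst h0
    by_cases hv : ∀ m, v m = 0
    · have : ∑ m, lag (v m) θ = 0 := Finset.sum_eq_zero fun m _ => by
        simp [hv m, lag, gain, hθ'.ne']
      rw [this, ENNReal.ofReal_of_nonpos]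
      · exact zero_le
      · apply div_nonpos_of_nonpos_of_nonneg _ (by positivity)
        have : (0 : ℝ) ≤ N * D / θ := by positivity
        linarith
    · push Not at hv
      obtain ⟨m, hm⟩ := hv
      have : waterRate v 0 = ∞ := by
        unfold waterRate
        rw [ENNReal.sum_eq_top.2 ⟨m, Finset.mem_univ _, modeRate_zero (pos_iff_ne_zero.2 hm)⟩]
        exact ENNReal.top_div_of_ne_top (ENNReal.natCast_ne_top _)
      rw [this]; exact le_top
  · replace h0 : 0 < μ := pos_iff_ne_zero.2 h0
    rw [waterRate_eq hN v h0]
    apply ENNReal.ofReal_le_ofReal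
    gcongr
    have := Finset.sum_le_sum fun m (_ : m ∈ Finset.univ) => lag_le (v m) h0 hθ
    rw [Finset.sum_add_distrib, ← Finset.sum_div] at this
    have h3 : (∑ m, min (v m : ℝ) μ) / θ ≤ N * D / θ := by gcongr
    linarith

lemma waterfillingRD_le {N : ℕ} (v : Fin N → ℝ≥0) (θ : ℝ≥0) :
    waterfillingRD v (waterDistortion v θ) ≤ waterRate v θ := by
  refine iInf₂_le θ (min_eq_left ?_).symm
  unfold waterDistortion
  gcongr
  exact min_le_left _ _

/-! ### Lagrangian duality for the allocation over the states. -/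

namespace GaussianMixture

variable {N K : ℕ} (S : GaussianMixture N K)

/-- The eigenvalues of the covariance of state `c`. -/
def eig (c : Fin K) : Fin N → ℝ≥0 := spectrumOf (S.cov_posSemidef c)

/-- The average rate, in nats per vector, at the common water level `θ`. -/
def meanGain (θ : ℝ≥0) : ℝ := ∑ c, (S.weight c : ℝ) * ∑ m, gain (S.eig c m) θ

/-- The average Lagrangian at the common water level `θ`. -/
def meanLag (θ : ℝ≥0) : ℝ := ∑ c, (S.weight c : ℝ) * ∑ m, lag (S.eig c m) θ

/-- The average distortion at the common water level `θ`. -/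
def meanDistortion (θ : ℝ≥0) : ℝ≥0 := ∑ c, S.weight c * waterDistortion (S.eig c) θ

lemma meanLag_eq (hN : 0 < N) (θ : ℝ≥0) :
    S.meanLag θ = S.meanGain θ + N * S.meanDistortion θ / θ := by
  have hN' : (N : ℝ) ≠ 0 := by exact_mod_cast hN.ne'
  simp only [meanLag, meanGain, meanDistortion, NNReal.coe_sum, NNReal.coe_mul,
    waterDistortion_coe, Finset.mul_sum, Finset.sum_div]
  rw [← Finset.sum_add_distrib]
  refine Finset.sum_congr rfl fun c _ => ?_
  rw [← Finset.sum_add_distrib]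
  refine Finset.sum_congr rfl fun m _ => ?_
  unfold lag
  field_simp

lemma meanGain_nonneg {θ : ℝ≥0} (hθ : 0 < θ) : 0 ≤ S.meanGain θ :=
  Finset.sum_nonneg fun c _ => mul_nonneg (S.weight c).coe_nonneg
    (Finset.sum_nonneg fun _ _ => gain_nonneg _ hθ)

/-- The dual lower bound on the benchmark. -/
lemma ofReal_meanLag_le_allocationRate (hN : 0 < N) {θ : ℝ≥0} (hθ : 0 < θ) {D : ℝ≥0}
    {d : Fin K → ℝ≥0} (hd : ∑ c, S.weight c * d c ≤ D) :
    ENNReal.ofReal ((S.meanLag θ - N * D / θ) / (N * Real.log 2)) ≤ S.allocationRate d := by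
  have hN' : (0 : ℝ) < N := by exact_mod_cast hN
  have hθ' : (0 : ℝ) < θ := hθ
  have h2 : 0 < Real.log 2 := Real.log_pos one_lt_two
  have hd' : ∑ c, (S.weight c : ℝ) * d c ≤ D := by exact_mod_cast hd
  calc ENNReal.ofReal ((S.meanLag θ - N * D / θ) / (N * Real.log 2))
      ≤ ENNReal.ofReal (∑ c, (S.weight c : ℝ) *
          ((∑ m, lag (S.eig c m) θ - N * d c / θ) / (N * Real.log 2))) := by
        apply ENNReal.ofReal_le_ofReal
        have : ∑ c, (S.weight c : ℝ) * ((∑ m, lag (S.eig c m) θ - N * d c / θ) / (N * Real.log 2))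
            = (S.meanLag θ - N * (∑ c, (S.weight c : ℝ) * d c) / θ) / (N * Real.log 2) := by
          unfold meanLag
          rw [Finset.mul_sum, Finset.sum_div, ← Finset.sum_sub_distrib, Finset.sum_div]
          refine Finset.sum_congr rfl fun c _ => ?_
          ring
        rw [this]
        gcongr
    _ ≤ ∑ c, ENNReal.ofReal ((S.weight c : ℝ) *
          ((∑ m, lag (S.eig c m) θ - N * d c / θ) / (N * Real.log 2))) := by
        refine Finset.le_sum_of_subadditive _ ENNReal.ofReal_zero.le
          (fun x y => ENNReal.ofReal_add_le) _ _
    _ ≤ S.allocationRate d := by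
        refine Finset.sum_le_sum fun c _ => ?_
        rw [ENNReal.ofReal_mul (S.weight c).coe_nonneg, ENNReal.ofReal_coe_nnreal]
        gcongr
        exact waterfillingRD_lower hN _ hθ _

lemma ofReal_meanLag_le_Rcond (hN : 0 < N) {θ : ℝ≥0} (hθ : 0 < θ) (D : ℝ≥0) :
    ENNReal.ofReal ((S.meanLag θ - N * D / θ) / (N * Real.log 2)) ≤ S.Rcond D :=
  le_iInf₂ fun _ hd => S.ofReal_meanLag_le_allocationRate hN hθ hd

lemma allocationRate_le (hN : 0 < N) {θ : ℝ≥0} (hθ : 0 < θ) :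
    S.allocationRate (fun c => waterDistortion (S.eig c) θ) ≤
      ENNReal.ofReal (S.meanGain θ / (N * Real.log 2)) := by
  have h2 : 0 < Real.log 2 := Real.log_pos one_lt_two
  have hg : ∀ c, 0 ≤ (∑ m, gain (S.eig c m) θ) / (N * Real.log 2) := fun c =>
    div_nonneg (Finset.sum_nonneg fun m _ => gain_nonneg _ hθ) (by positivity)
  unfold allocationRate meanGain
  rw [Finset.sum_div, ENNReal.ofReal_sum_of_nonneg]
  · refine Finset.sum_le_sum fun c _ => ?_
    rw [mul_div_assoc, ENNReal.ofReal_mul (S.weight c).coe_nonneg, ENNReal.ofReal_coe_nnreal,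
      ← waterRate_eq hN _ hθ]
    gcongr
    exact waterfillingRD_le _ _
  · intro c _
    rw [mul_div_assoc]
    exact mul_nonneg (S.weight c).coe_nonneg (hg c)

/-- At the level v·exp(−t) the chosen mode alone has gain t, which is arbitrarily large. This makes
the dual bounds at D = 0 unbounded, matching an infinite benchmark. -/
lemma exists_meanLag_ge (hN : 0 < N) {c : Fin K} {m : Fin N} (h : 0 < S.eig c m) (B : ℝ) :
    ∃ θ : ℝ≥0, 0 < θ ∧ B ≤ S.meanLag θ / (N * Real.log 2) := by
  have hN' : (0 : ℝ) < N := by exact_mod_cast hN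
  have h2 : 0 < Real.log 2 := Real.log_pos one_lt_two
  have hw : (0 : ℝ) < S.weight c := S.weight_pos c
  have hv : (0 : ℝ) < S.eig c m := h
  -- Chosen so that the weighted gain of this single mode is |B|·N·log 2; the absolute value keeps t
  -- ≥ 0, hence θ ≤ v.
  set t : ℝ := |B| * (N * Real.log 2) / S.weight c with ht
  have hte : (0 : ℝ) < S.eig c m * Real.exp (-t) := by positivity
  refine ⟨⟨_, hte.le⟩, hte, ?_⟩
  set θ : ℝ≥0 := ⟨_, hte.le⟩
  have hθ : 0 < θ := hte
  have h1 : t ≤ gain (S.eig c m) θ := by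
    have h3 : (θ : ℝ) = S.eig c m * Real.exp (-t) := rfl
    have ht0 : 0 ≤ t := by positivity
    have h4 : (θ : ℝ) ≤ S.eig c m := by
      rw [h3]
      exact mul_le_of_le_one_right hv.le (Real.exp_le_one_iff.2 (by linarith))
    rw [gain, max_eq_left h4, h3, Real.log_div hv.ne' hte.ne', Real.log_mul hv.ne'
      (Real.exp_pos _).ne', Real.log_exp]
    linarith
  have h5 : S.weight c * t ≤ S.meanLag θ := by
    calc S.weight c * t ≤ S.weight c * ∑ m, lag (S.eig c m) θ := by
          gcongr
          refine le_trans ?_ (Finset.single_le_sum (f := fun m => lag (S.eig c m) θ)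
            (fun m _ => lag_nonneg _ hθ) (Finset.mem_univ m))
          exact h1.trans (le_add_of_nonneg_right (by positivity))
      _ ≤ _ := Finset.single_le_sum (f := fun c => (S.weight c : ℝ) * ∑ m, lag (S.eig c m) θ)
            (fun c _ => mul_nonneg (S.weight c).coe_nonneg
              (Finset.sum_nonneg fun m _ => lag_nonneg _ hθ)) (Finset.mem_univ c)
  rw [le_div_iff₀ (by positivity)]
  have h6 : S.weight c * t = |B| * (N * Real.log 2) := by rw [ht]; field_simp
  rw [h6] at h5
  refine le_trans ?_ h5
  gcongr
  exact le_abs_self B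

/-- Either a common positive water level solves the allocation problem at distortion `D`, or
`D = 0` and some mode is nondegenerate. -/
lemma exists_level (D : ℝ≥0) :
    (∃ θ : ℝ≥0, 0 < θ ∧ S.meanDistortion θ ≤ D ∧
      (S.meanGain θ = 0 ∨ S.meanDistortion θ = D)) ∨ (D = 0 ∧ ∃ c m, 0 < S.eig c m) := by
  -- A level above all eigenvalues, where no mode is coded; the summand 1 keeps it positive when all
  -- covariances vanish.
  set T : ℝ≥0 := 1 + ∑ c, ∑ m, S.eig c m with hT
  have hTpos : 0 < T := by positivity
  have hvT : ∀ c m, S.eig c m ≤ T := fun c m =>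
    calc S.eig c m ≤ ∑ m, S.eig c m :=
          Finset.single_le_sum (f := fun m => S.eig c m) (fun _ _ => zero_le) (Finset.mem_univ m)
      _ ≤ ∑ c, ∑ m, S.eig c m := Finset.single_le_sum (f := fun c => ∑ m, S.eig c m)
          (fun _ _ => zero_le) (Finset.mem_univ c)
      _ ≤ T := by rw [hT]; exact le_add_self
  have hgT : S.meanGain T = 0 := Finset.sum_eq_zero fun c _ => by
    rw [Finset.sum_eq_zero fun m _ => gain_eq_zero hTpos (hvT c m), mul_zero]
  have h0 : S.meanDistortion 0 = 0 := by simp [meanDistortion, waterDistortion]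
  rcases le_total (S.meanDistortion T) D with h | h
  · exact Or.inl ⟨T, hTpos, h, Or.inl hgT⟩
  · rcases eq_or_ne D 0 with hD | hD
    · subst hD
      by_cases hv : ∀ c m, S.eig c m = 0
      · refine Or.inl ⟨T, hTpos, ?_, Or.inl hgT⟩
        simp [meanDistortion, waterDistortion, hv]
      · push Not at hv
        obtain ⟨c, m, hm⟩ := hv
        exact Or.inr ⟨rfl, c, m, pos_iff_ne_zero.2 hm⟩
    · have hc : Continuous S.meanDistortion := by
        unfold meanDistortion waterDistortion
        fun_prop
      obtain ⟨θ, -, hθ⟩ := intermediate_value_Icc (bot_le (a := T)) hc.continuousOn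
        (show D ∈ Set.Icc (S.meanDistortion 0) (S.meanDistortion T) from ⟨by simp [h0], h⟩)
      refine Or.inl ⟨θ, pos_iff_ne_zero.2 ?_, hθ.le, Or.inr hθ⟩
      rintro rfl
      exact hD (hθ.symm.trans h0)

/-- Complementary slackness: if the budget is exhausted, the dual bound equals the rate; if the rate
is zero, nothing is needed. -/
lemma meanGain_le_meanLag (hN : 0 < N) {θ D : ℝ≥0}
    (h : S.meanGain θ = 0 ∨ S.meanDistortion θ = D) :
    ENNReal.ofReal (S.meanGain θ / (N * Real.log 2)) ≤
      ENNReal.ofReal ((S.meanLag θ - N * D / θ) / (N * Real.log 2)) := by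
  rcases h with h | h
  · simp [h]
  · rw [S.meanLag_eq hN, h, add_sub_cancel_right]

/-- A quantity that dominates every dual bound dominates the benchmark. -/
lemma Rcond_le_of_forall (hN : 0 < N) {D : ℝ≥0} {x : ℝ≥0∞}
    (h : ∀ θ : ℝ≥0, 0 < θ →
      ENNReal.ofReal ((S.meanLag θ - N * D / θ) / (N * Real.log 2)) ≤ x) : S.Rcond D ≤ x := by
  rcases S.exists_level D with ⟨θ, hθ, hD, hor⟩ | ⟨rfl, c, m, hcm⟩
  · exact (iInf₂_le (fun c => waterDistortion (S.eig c) θ) hD).trans <|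
      (S.allocationRate_le hN hθ).trans <| (S.meanGain_le_meanLag hN hor).trans (h θ hθ)
  · have : x = ∞ := by
      refine ENNReal.eq_top_of_forall_nnreal_le fun r => ?_
      obtain ⟨θ, hθ, hr⟩ := S.exists_meanLag_ge hN hcm r
      refine le_trans ?_ (h θ hθ)
      rw [← ENNReal.ofReal_coe_nnreal]
      exact ENNReal.ofReal_le_ofReal (by simpa using hr)
    rw [this]; exact le_top

/-- A quantity below the rate of every feasible common water level is below the benchmark. -/
lemma le_Rcond_of_forall (hN : 0 < N) {D : ℝ≥0} {x : ℝ≥0∞}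
    (h : ∀ θ : ℝ≥0, 0 < θ → S.meanDistortion θ ≤ D →
      x ≤ ENNReal.ofReal (S.meanGain θ / (N * Real.log 2))) : x ≤ S.Rcond D := by
  rcases S.exists_level D with ⟨θ, hθ, hD, hor⟩ | ⟨rfl, c, m, hcm⟩
  · exact (h θ hθ hD).trans <|
      (S.meanGain_le_meanLag hN hor).trans (S.ofReal_meanLag_le_Rcond hN hθ D)
  · have : S.Rcond 0 = ∞ := by
      refine ENNReal.eq_top_of_forall_nnreal_le fun r => ?_
      obtain ⟨θ, hθ, hr⟩ := S.exists_meanLag_ge hN hcm r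
      refine le_trans ?_ (S.ofReal_meanLag_le_Rcond hN hθ 0)
      rw [← ENNReal.ofReal_coe_nnreal]
      exact ENNReal.ofReal_le_ofReal (by simpa using hr)
    rw [this]; exact le_top

/-- The minimum that defines the benchmark is attained. -/
lemma exists_allocationRate_eq_Rcond (hN : 0 < N) (D : ℝ≥0) :
    ∃ d : Fin K → ℝ≥0, ∑ c, S.weight c * d c ≤ D ∧ S.allocationRate d = S.Rcond D := by
  rcases S.exists_level D with ⟨θ, hθ, hD, hor⟩ | ⟨rfl, c, m, hcm⟩
  · exact ⟨fun c => waterDistortion (S.eig c) θ, hD, le_antisymm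
      ((S.allocationRate_le hN hθ).trans <|
        (S.meanGain_le_meanLag hN hor).trans (S.ofReal_meanLag_le_Rcond hN hθ D))
      (iInf₂_le (fun c => waterDistortion (S.eig c) θ) hD)⟩
  -- Positive weights force d = 0 when D = 0, so the infimum runs over a single allocation.
  · refine ⟨0, by simp, le_antisymm (le_iInf₂ fun d hd => ?_) (iInf₂_le _ (by simp))⟩
    have : d = 0 := by
      funext c
      have := (Finset.sum_eq_zero_iff.1 (le_antisymm hd (zero_le))) c (Finset.mem_univ c)
      exact (mul_eq_zero.1 this).resolve_left (S.weight_pos c).ne'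
    rw [this]

end GaussianMixture

/-! ### Products of densities -/

section Pi

variable {ι : Type*} [Fintype ι]

lemma lintegral_pi_prod {X : ι → Type*} [∀ i, MeasurableSpace (X i)] (μ : ∀ i, Measure (X i))
    [∀ i, IsProbabilityMeasure (μ i)] {f : ∀ i, X i → ℝ≥0∞} (hf : ∀ i, Measurable (f i)) :
    ∫⁻ x, ∏ i, f i (x i) ∂(Measure.pi μ) = ∏ i, ∫⁻ x, f i x ∂(μ i) := by
  refine (lintegral_prod_eq_prod_lintegral_of_indepFun Finset.univ
    (fun i (x : ∀ i, X i) => f i (x i)) (iIndepFun_pi fun i => (hf i).aemeasurable)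
    (fun i => (hf i).comp (measurable_pi_apply i))).trans ?_
  exact Finset.prod_congr rfl fun i _ => (measurePreserving_eval μ i).lintegral_comp (hf i)

lemma pi_withDensity {X : ι → Type*} [∀ i, MeasurableSpace (X i)] (μ : ∀ i, Measure (X i))
    [∀ i, IsProbabilityMeasure (μ i)] {f : ∀ i, X i → ℝ≥0∞} (hf : ∀ i, Measurable (f i))
    [∀ i, SigmaFinite ((μ i).withDensity (f i))] :
    Measure.pi (fun i => (μ i).withDensity (f i)) =
      (Measure.pi μ).withDensity (fun x => ∏ i, f i (x i)) := by
  refine Measure.pi_eq fun s hs => ?_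
  rw [withDensity_apply _ (MeasurableSet.univ_pi hs),
    ← lintegral_indicator (MeasurableSet.univ_pi hs)]
  have : (fun x => (Set.univ.pi s).indicator (fun x => ∏ i, f i (x i)) x) =
      fun x => ∏ i, (s i).indicator (f i) (x i) := by
    funext x
    by_cases hx : x ∈ Set.univ.pi s
    · rw [Set.indicator_of_mem hx]
      exact Finset.prod_congr rfl fun i _ => by rw [Set.indicator_of_mem (hx i (Set.mem_univ i))]
    · rw [Set.indicator_of_notMem hx]
      simp only [Set.mem_pi, Set.mem_univ, true_imp_iff, not_forall] at hx
      obtain ⟨i, hi⟩ := hx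
      exact (Finset.prod_eq_zero (Finset.mem_univ i) (Set.indicator_of_notMem hi _)).symm
  rw [this, lintegral_pi_prod μ fun i => (hf i).indicator (hs i)]
  refine Finset.prod_congr rfl fun i _ => ?_
  rw [lintegral_indicator (hs i), withDensity_apply _ (hs i)]

lemma map_pi_withDensity {X Y : Type*} [MeasurableSpace X] [MeasurableSpace Y]
    (μ : ι → Measure X) (ν : ι → Measure Y) [∀ i, IsProbabilityMeasure (μ i)]
    [∀ i, IsProbabilityMeasure (ν i)] {f : ι → X × Y → ℝ≥0∞} (hf : ∀ i, Measurable (f i))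
    [∀ i, SigmaFinite (((μ i).prod (ν i)).withDensity (f i))] :
    (Measure.pi fun i => ((μ i).prod (ν i)).withDensity (f i)).map
        (fun z => (fun i => (z i).1, fun i => (z i).2)) =
      ((Measure.pi μ).prod (Measure.pi ν)).withDensity
        (fun z => ∏ i, f i (z.1 i, z.2 i)) := by
  have he : Measurable (fun z : ι → X × Y => ((fun i => (z i).1, fun i => (z i).2) :
    (ι → X) × (ι → Y))) := by fun_prop
  have hmp := (measurePreserving_arrowProdEquivProdArrow X Y ι μ ν).map_eq
  change Measure.map (fun z : ι → X × Y => ((fun i => (z i).1, fun i => (z i).2) :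
    (ι → X) × (ι → Y))) _ = _ at hmp
  rw [pi_withDensity _ hf, ← hmp]
  have hF : Measurable fun z : (ι → X) × (ι → Y) => ∏ i, f i (z.1 i, z.2 i) :=
    Finset.measurable_prod _ fun i _ => (hf i).comp (by fun_prop)
  have hF' : Measurable fun z : ι → X × Y => ∏ i, f i (z i) :=
    Finset.measurable_prod _ fun i _ => (hf i).comp (by fun_prop)
  refine Measure.ext_of_lintegral _ fun φ hφ => ?_
  rw [lintegral_map hφ he, lintegral_withDensity_eq_lintegral_mul _ hF hφ,
    lintegral_map (hF.mul hφ) he]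
  exact lintegral_withDensity_eq_lintegral_mul _ hF' (hφ.comp he)

end Pi

/-! ### Variational bounds on the relative entropy -/

section KL

variable {Ω : Type*} [MeasurableSpace Ω]

/-- Jensen's inequality through x + 1 ≤ exp x. It serves both the relative entropy bound and the
converse for codes. -/
lemma integral_nonpos_of_lintegral_exp_le_one {P : Measure Ω} [IsProbabilityMeasure P]
    {F : Ω → ℝ} (hF : Integrable F P) (h : ∫⁻ ω, ENNReal.ofReal (Real.exp (F ω)) ∂P ≤ 1) :
    ∫ ω, F ω ∂P ≤ 0 := by
  have hm : AEStronglyMeasurable (fun ω => Real.exp (F ω)) P :=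
    Real.continuous_exp.comp_aestronglyMeasurable hF.1
  have hint : Integrable (fun ω => Real.exp (F ω)) P := by
    refine ⟨hm, ?_⟩
    rw [hasFiniteIntegral_iff_ofReal (Eventually.of_forall fun _ => (Real.exp_pos _).le)]
    exact h.trans_lt ENNReal.one_lt_top
  have h1 : ∫ ω, Real.exp (F ω) ∂P ≤ 1 := by
    rw [integral_eq_lintegral_of_nonneg_ae (Eventually.of_forall fun _ => (Real.exp_pos _).le) hm]
    exact ENNReal.toReal_le_of_le_ofReal zero_le_one (by simpa using h)
  have h2 : ∫ ω, F ω ∂P ≤ ∫ ω, (Real.exp (F ω) - 1) ∂P :=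
    integral_mono hF (hint.sub (integrable_const _)) fun ω => by
      have := Real.add_one_le_exp (F ω)
      simp only; linarith
  rw [integral_sub hint (integrable_const _)] at h2
  simp at h2
  linarith

/-- The Donsker–Varadhan lower bound. -/
lemma ofReal_integral_le_klDiv {ρ σ : Measure Ω} [IsProbabilityMeasure ρ]
    [IsProbabilityMeasure σ] {F : Ω → ℝ} (hFm : Measurable F) (hF : Integrable F ρ)
    (h : ∫⁻ ω, ENNReal.ofReal (Real.exp (F ω)) ∂σ ≤ 1) :
    ENNReal.ofReal (∫ ω, F ω ∂ρ) ≤ klDiv ρ σ := by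
  by_cases htop : klDiv ρ σ = ∞
  · rw [htop]; exact le_top
  obtain ⟨hac, hint⟩ := klDiv_ne_top_iff.1 htop
  rw [klDiv_of_ac_of_integrable hac hint]
  apply ENNReal.ofReal_le_ofReal
  -- Changing measure from ρ to σ cancels the density against exp(−llr), leaving at most the
  -- integral of exp F; points of zero density contribute nothing.
  have key : ∫ ω, (F ω - llr ρ σ ω) ∂ρ ≤ 0 := by
    refine integral_nonpos_of_lintegral_exp_le_one (hF.sub hint) (le_trans ?_ h)
    rw [← lintegral_rnDeriv_mul hac (by
      have := (measurable_llr ρ σ)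
      fun_prop)]
    refine lintegral_mono_ae ?_
    filter_upwards [Measure.rnDeriv_lt_top ρ σ] with ω hω
    by_cases h0 : ρ.rnDeriv σ ω = 0
    · simp [h0]
    · have hp : 0 < (ρ.rnDeriv σ ω).toReal := ENNReal.toReal_pos h0 hω.ne
      rw [llr, Real.exp_sub, Real.exp_log hp]
      nth_rw 1 [← ENNReal.ofReal_toReal hω.ne]
      rw [← ENNReal.ofReal_mul hp.le, mul_div_cancel₀ _ hp.ne']
  rw [integral_sub hF hint] at key
  simp
  linarith

lemma klDiv_withDensity_exp {ρ σ : Measure Ω} [IsProbabilityMeasure ρ] [IsProbabilityMeasure σ]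
    {F : Ω → ℝ} (hFm : Measurable F)
    (hρ : ρ = σ.withDensity fun ω => ENNReal.ofReal (Real.exp (F ω))) (hF : Integrable F ρ) :
    klDiv ρ σ = ENNReal.ofReal (∫ ω, F ω ∂ρ) := by
  have hac : ρ ≪ σ := hρ ▸ withDensity_absolutelyContinuous _ _
  have hm : Measurable fun ω => ENNReal.ofReal (Real.exp (F ω)) := by fun_prop
  have hae : llr ρ σ =ᵐ[ρ] F := by
    refine hac.ae_le ?_
    have := Measure.rnDeriv_withDensity σ hm
    rw [← hρ] at this
    filter_upwards [this] with ω hω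
    rw [llr, hω, ENNReal.toReal_ofReal (Real.exp_pos _).le, Real.log_exp]
  rw [klDiv_of_ac_of_integrable hac (hF.congr hae.symm), integral_congr_ae hae]
  simp

variable {X Y : Type*} [MeasurableSpace X] [MeasurableSpace Y]

/-- The dual (Csiszár) lower bound on the mutual information of a pair. -/
lemma ofReal_le_mutualInfo {ρ : Measure (X × Y)} [IsProbabilityMeasure ρ]
    {A : X → ℝ} {q : X × Y → ℝ} (hA : Measurable A) (hq : Measurable q)
    (hAi : Integrable A ρ.fst) (hqi : Integrable q ρ)
    (h : ∀ y, ∫⁻ x, ENNReal.ofReal (Real.exp (A x - q (x, y))) ∂ρ.fst ≤ 1) :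
    ENNReal.ofReal ((∫ x, A x ∂ρ.fst - ∫ z, q z ∂ρ) / Real.log 2) ≤ mutualInfo ρ := by
  unfold mutualInfo
  rw [ENNReal.ofReal_div_of_pos (Real.log_pos one_lt_two)]
  gcongr
  have hAρ : Integrable (fun z : X × Y => A z.1) ρ :=
    (integrable_map_measure hA.aestronglyMeasurable measurable_fst.aemeasurable).1 hAi
  have hAeq : ∫ x, A x ∂ρ.fst = ∫ z, A z.1 ∂ρ :=
    integral_map measurable_fst.aemeasurable hA.aestronglyMeasurable
  rw [hAeq, ← integral_sub hAρ hqi]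
  refine ofReal_integral_le_klDiv (by fun_prop) (hAρ.sub hqi) ?_
  -- With x integrated first, the hypothesis bounds the inner integral for every y, so the output
  -- law plays no role.
  rw [lintegral_prod_symm _ (by fun_prop)]
  calc _ ≤ ∫⁻ _, 1 ∂ρ.snd := lintegral_mono fun y => h y
    _ = 1 := by simp

lemma mutualInfo_eq {ρ : Measure (X × Y)} [IsProbabilityMeasure ρ] {F : X × Y → ℝ}
    (hFm : Measurable F)
    (hρ : ρ = (ρ.fst.prod ρ.snd).withDensity fun z => ENNReal.ofReal (Real.exp (F z)))
    (hF : Integrable F ρ) :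
    mutualInfo ρ = ENNReal.ofReal ((∫ z, F z ∂ρ) / Real.log 2) := by
  unfold mutualInfo
  rw [ENNReal.ofReal_div_of_pos (Real.log_pos one_lt_two), klDiv_withDensity_exp hFm hρ hF]

end KL

/-! ### Matched pairs: optimal test channels together with their dual certificates -/

section Matched

variable {X Y X' Y' : Type*} [MeasurableSpace X] [MeasurableSpace Y] [MeasurableSpace X']
  [MeasurableSpace Y']

/-- The joint law with density `exp (A x - q (x, y))` with respect to `μ × ν`. -/
def coupling (μ : Measure X) (ν : Measure Y) (A : X → ℝ) (q : X × Y → ℝ) : Measure (X × Y) :=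
  (μ.prod ν).withDensity fun z => ENNReal.ofReal (Real.exp (A z.1 - q z))

/-- A source law `μ` and a reproduction law `ν`, together with a potential `A` and a normalised
cost `q`, such that the joint law of density `exp (A x - q (x, y))` is a coupling and `A` is
feasible for the dual problem. -/
structure MatchedPair (μ : Measure X) (ν : Measure Y) (A : X → ℝ) (q : X × Y → ℝ) (Λ Δ : ℝ) :
    Prop where
  prob_left : IsProbabilityMeasure μ
  prob_right : IsProbabilityMeasure ν
  measurable_potential : Measurable A
  measurable_cost : Measurable q
  memLp_potential : MemLp A 2 μ
  integral_potential : ∫ x, A x ∂μ = Λ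
  dual_le_one : ∀ y, ∫⁻ x, ENNReal.ofReal (Real.exp (A x - q (x, y))) ∂μ ≤ 1
  fst_coupling : (coupling μ ν A q).fst = μ
  memLp_cost : MemLp q 2 (coupling μ ν A q)
  integral_cost : ∫ z, q z ∂(coupling μ ν A q) = Δ
  exists_ref : ∃ y₀, MemLp (fun x => q (x, y₀)) 2 μ

lemma isProbabilityMeasure_of_fst {μ : Measure X} [IsProbabilityMeasure μ] {ρ : Measure (X × Y)}
    (h : ρ.fst = μ) : IsProbabilityMeasure ρ :=
  ⟨by rw [← Measure.fst_univ, h, measure_univ]⟩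

lemma MatchedPair.isProbabilityMeasure_coupling {μ : Measure X} {ν : Measure Y} {A : X → ℝ}
    {q : X × Y → ℝ} {Λ Δ : ℝ} (h : MatchedPair μ ν A q Λ Δ) :
    IsProbabilityMeasure (coupling μ ν A q) :=
  have := h.prob_left
  isProbabilityMeasure_of_fst h.fst_coupling

/-- Dual feasibility puts the second marginal below ν, and both have mass one. This is why the
structure records only the first marginal. -/
lemma MatchedPair.snd_coupling {μ : Measure X} {ν : Measure Y} {A : X → ℝ}
    {q : X × Y → ℝ} {Λ Δ : ℝ} (h : MatchedPair μ ν A q Λ Δ) :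
    (coupling μ ν A q).snd = ν := by
  have := h.prob_left
  have := h.prob_right
  have := h.isProbabilityMeasure_coupling
  have hA := h.measurable_potential
  have hq := h.measurable_cost
  refine Measure.eq_of_le_of_measure_univ_eq (Measure.le_iff.2 fun s hs => ?_) (by simp)
  rw [Measure.snd_apply hs, coupling, withDensity_apply _ (measurable_snd hs),
    ← lintegral_indicator (measurable_snd hs), lintegral_prod_symm]
  · calc _ ≤ ∫⁻ y, s.indicator 1 y ∂ν := by
          refine lintegral_mono fun y => ?_
          by_cases hy : y ∈ s
          · simpa [Set.indicator, hy] using h.dual_le_one y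
          · simp [Set.indicator, hy]
      _ = ν s := by simp [lintegral_indicator_one hs]
  · exact (Measurable.indicator (by fun_prop) (measurable_snd hs)).aemeasurable

lemma lintegral_coupling {μ : Measure X} {ν : Measure Y} [SFinite ν] {A : X → ℝ} {q : X × Y → ℝ}
    (hA : Measurable A) (hq : Measurable q) {φ : X × Y → ℝ≥0∞} (hφ : Measurable φ) :
    ∫⁻ z, φ z ∂(coupling μ ν A q) =
      ∫⁻ x, ∫⁻ y, ENNReal.ofReal (Real.exp (A x - q (x, y))) * φ (x, y) ∂ν ∂μ := by
  rw [coupling, lintegral_withDensity_eq_lintegral_mul _ (by fun_prop) hφ,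
    lintegral_prod _ (by fun_prop)]
  rfl

/-- The new cost is supplied explicitly, not as a pullback, so that it can be the squared norm in
the new coordinates. -/
lemma MatchedPair.map {μ : Measure X} {ν : Measure Y} {A : X → ℝ} {q : X × Y → ℝ} {Λ Δ : ℝ}
    (h : MatchedPair μ ν A q Λ Δ) (e : X ≃ᵐ X') (e' : Y ≃ᵐ Y') {q' : X' × Y' → ℝ}
    (hq' : Measurable q') (hqq : ∀ x y, q' (e x, e' y) = q (x, y)) :
    MatchedPair (μ.map e) (ν.map e') (A ∘ e.symm) q' Λ Δ := by
  have := h.prob_left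
  have := h.prob_right
  have hA := h.measurable_potential
  have hq := h.measurable_cost
  have hA' : Measurable (A ∘ e.symm) := hA.comp e.symm.measurable
  have hpm : Measurable (Prod.map e e') := e.measurable.prodMap e'.measurable
  have hpν : IsProbabilityMeasure (ν.map e') :=
    Measure.isProbabilityMeasure_map e'.measurable.aemeasurable
  have hc : coupling (μ.map e) (ν.map e') (A ∘ e.symm) q' =
      (coupling μ ν A q).map (Prod.map e e') := by
    refine Measure.ext_of_lintegral _ fun φ hφ => ?_
    have h1 := lintegral_coupling (μ := μ) (ν := ν) hA hq (hφ.comp hpm)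
    simp only [Function.comp_apply] at h1
    rw [lintegral_map hφ hpm, lintegral_coupling hA' hq' hφ, h1, lintegral_map ?_ e.measurable]
    · refine lintegral_congr fun x => ?_
      rw [lintegral_map (by fun_prop) e'.measurable]
      simp [hqq]
    · exact Measurable.lintegral_prod_right (by fun_prop)
  have hqc : q' ∘ Prod.map e e' = q := by
    funext z; exact hqq z.1 z.2
  refine ⟨Measure.isProbabilityMeasure_map e.measurable.aemeasurable, hpν, hA', hq', ?_, ?_, ?_,
    ?_, ?_, ?_, ?_⟩
  · rw [memLp_map_measure_iff hA'.aestronglyMeasurable e.measurable.aemeasurable]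
    simpa [Function.comp_def] using h.memLp_potential
  · rw [integral_map e.measurable.aemeasurable hA'.aestronglyMeasurable]
    simpa using h.integral_potential
  · intro y
    rw [lintegral_map (by fun_prop) e.measurable]
    have := h.dual_le_one (e'.symm y)
    simpa [← hqq] using this
  · rw [hc, Measure.fst, Measure.map_map measurable_fst hpm]
    conv_rhs => rw [← h.fst_coupling, Measure.fst, Measure.map_map e.measurable measurable_fst]
    rfl
  · rw [hc, memLp_map_measure_iff hq'.aestronglyMeasurable hpm.aemeasurable, hqc]
    exact h.memLp_cost
  · rw [hc, integral_map hpm.aemeasurable hq'.aestronglyMeasurable, ← h.integral_cost, ← hqc]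
    rfl
  · obtain ⟨y₀, hy⟩ := h.exists_ref
    refine ⟨e' y₀, ?_⟩
    rw [memLp_map_measure_iff (Measurable.aestronglyMeasurable (by fun_prop))
      e.measurable.aemeasurable]
    simpa [Function.comp_def, hqq] using hy

lemma ofReal_exp_sum_sub_sum {ι α β : Type*} [Fintype ι] (A : ι → α → ℝ) (q : ι → α × β → ℝ)
    (x : ι → α) (y : ι → β) :
    ENNReal.ofReal (Real.exp (∑ i, A i (x i) - ∑ i, q i (x i, y i))) =
      ∏ i, ENNReal.ofReal (Real.exp (A i (x i) - q i (x i, y i))) := by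
  rw [← Finset.sum_sub_distrib, Real.exp_sum,
    ENNReal.ofReal_prod_of_nonneg fun i _ => (Real.exp_pos _).le]

/-- The coupling of a product of matched pairs is the product of the couplings. -/
lemma coupling_pi {ι : Type*} [Fintype ι] {μ : ι → Measure X} {ν : ι → Measure Y}
    {A : ι → X → ℝ} {q : ι → X × Y → ℝ} {Λ Δ : ι → ℝ}
    (h : ∀ i, MatchedPair (μ i) (ν i) (A i) (q i) (Λ i) (Δ i)) :
    coupling (Measure.pi μ) (Measure.pi ν) (fun x => ∑ i, A i (x i))
      (fun z => ∑ i, q i (z.1 i, z.2 i)) =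
      (Measure.pi fun i => coupling (μ i) (ν i) (A i) (q i)).map
        (fun z => (fun i => (z i).1, fun i => (z i).2)) := by
  have := fun i => (h i).prob_left
  have := fun i => (h i).prob_right
  have hA := fun i => (h i).measurable_potential
  have hq := fun i => (h i).measurable_cost
  have hsf : ∀ i, SigmaFinite (((μ i).prod (ν i)).withDensity
      fun z => ENNReal.ofReal (Real.exp (A i z.1 - q i z))) := fun i => by
    have := (h i).isProbabilityMeasure_coupling
    change SigmaFinite (coupling (μ i) (ν i) (A i) (q i))
    infer_instance
  have := map_pi_withDensity μ ν
    (f := fun i z => ENNReal.ofReal (Real.exp (A i z.1 - q i z))) (fun i => by fun_prop)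
  simp only [coupling]
  rw [this]
  congr 1
  funext z
  exact ofReal_exp_sum_sub_sum A q z.1 z.2

/-- Potentials and costs add, so the exponentials, the dual integrals and the couplings factor. Used
for real and imaginary parts, for eigenmodes, and for the letters of a block. -/
lemma MatchedPair.pi {ι : Type*} [Fintype ι] {μ : ι → Measure X} {ν : ι → Measure Y}
    {A : ι → X → ℝ} {q : ι → X × Y → ℝ} {Λ Δ : ι → ℝ}
    (h : ∀ i, MatchedPair (μ i) (ν i) (A i) (q i) (Λ i) (Δ i)) :
    MatchedPair (Measure.pi μ) (Measure.pi ν) (fun x => ∑ i, A i (x i))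
      (fun z => ∑ i, q i (z.1 i, z.2 i)) (∑ i, Λ i) (∑ i, Δ i) := by
  have := fun i => (h i).prob_left
  have := fun i => (h i).prob_right
  have := fun i => (h i).isProbabilityMeasure_coupling
  have hA := fun i => (h i).measurable_potential
  have hq := fun i => (h i).measurable_cost
  have hs : Measurable (fun z : ι → X × Y => ((fun i => (z i).1, fun i => (z i).2) :
    (ι → X) × (ι → Y))) := by fun_prop
  have hAm : Measurable fun x : ι → X => ∑ i, A i (x i) :=
    Finset.measurable_sum _ fun i _ => (hA i).comp (by fun_prop)
  have hqm : Measurable fun z : (ι → X) × (ι → Y) => ∑ i, q i (z.1 i, z.2 i) :=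
    Finset.measurable_sum _ fun i _ => (hq i).comp (by fun_prop)
  have hc := coupling_pi h
  have hev : ∀ i, MeasurePreserving (Function.eval i)
      (Measure.pi fun i => coupling (μ i) (ν i) (A i) (q i)) (coupling (μ i) (ν i) (A i) (q i)) :=
    fun i => measurePreserving_eval _ i
  have hmemA : ∀ i, MemLp (fun x : ι → X => A i (x i)) 2 (Measure.pi μ) := fun i =>
    (h i).memLp_potential.comp_measurePreserving (measurePreserving_eval μ i)
  have hmemq : ∀ i, MemLp (fun z : ι → X × Y => q i (z i)) 2
      (Measure.pi fun i => coupling (μ i) (ν i) (A i) (q i)) := fun i =>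
    (h i).memLp_cost.comp_measurePreserving (hev i)
  refine ⟨inferInstance, inferInstance, hAm, hqm, memLp_finsetSum _ fun i _ => hmemA i, ?_, ?_,
    ?_, ?_, ?_, ?_⟩
  · rw [integral_finsetSum _ fun i _ => (hmemA i).integrable one_le_two]
    refine Finset.sum_congr rfl fun i _ => ?_
    rw [← (h i).integral_potential]
    exact integral_comp_eval (hA i).aestronglyMeasurable
  · intro y
    simp only [ofReal_exp_sum_sub_sum A q _ y]
    rw [lintegral_pi_prod μ (f := fun i x => ENNReal.ofReal (Real.exp (A i x - q i (x, y i))))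
      fun i => by fun_prop]
    exact Finset.prod_le_one' fun i _ => (h i).dual_le_one (y i)
  · have hf : ∀ i, (coupling (μ i) (ν i) (A i) (q i)).map Prod.fst = μ i :=
      fun i => (h i).fst_coupling
    have hsf : ∀ i, SigmaFinite ((coupling (μ i) (ν i) (A i) (q i)).map Prod.fst) := fun i => by
      rw [hf i]; infer_instance
    rw [hc, Measure.fst, Measure.map_map measurable_fst hs]
    have := Measure.pi_map_pi (μ := fun i => coupling (μ i) (ν i) (A i) (q i))
      (f := fun _ => Prod.fst) fun i => measurable_fst.aemeasurable
    simp only [hf] at this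
    exact this
  · rw [hc, memLp_map_measure_iff hqm.aestronglyMeasurable hs.aemeasurable]
    exact memLp_finsetSum _ fun i _ => hmemq i
  · rw [hc, integral_map hs.aemeasurable hqm.aestronglyMeasurable]
    rw [integral_finsetSum _ fun i _ => (hmemq i).integrable one_le_two]
    refine Finset.sum_congr rfl fun i _ => ?_
    rw [← (h i).integral_cost]
    exact integral_comp_eval (μ := fun i => coupling (μ i) (ν i) (A i) (q i))
      (hq i).aestronglyMeasurable
  · choose y₀ hy₀ using fun i => (h i).exists_ref
    exact ⟨y₀, memLp_finsetSum _ fun i _ =>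
      (hy₀ i).comp_measurePreserving (measurePreserving_eval μ i)⟩

/-! ### Finite mixtures -/

variable {K : ℕ}

/-- The joint law of a state with probabilities `w` and an observation with law `μ c` in state
`c`. -/
def mix (w : Fin K → ℝ≥0) (μ : Fin K → Measure X) : Measure (Fin K × X) :=
  ∑ c, (w c : ℝ≥0∞) • (Measure.dirac c).prod (μ c)

lemma mix_eq (w : Fin K → ℝ≥0) (μ : Fin K → Measure X) [∀ c, SFinite (μ c)] :
    mix w μ = ∑ c, (w c : ℝ≥0∞) • (μ c).map (Prod.mk c) := by
  simp [mix, Measure.dirac_prod]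

lemma lintegral_mix (w : Fin K → ℝ≥0) (μ : Fin K → Measure X) [∀ c, SFinite (μ c)]
    {φ : Fin K × X → ℝ≥0∞} (hφ : Measurable φ) :
    ∫⁻ z, φ z ∂(mix w μ) = ∑ c, (w c : ℝ≥0∞) * ∫⁻ x, φ (c, x) ∂(μ c) := by
  rw [mix_eq, lintegral_finsetSum_measure]
  refine Finset.sum_congr rfl fun c _ => ?_
  rw [lintegral_smul_measure, lintegral_map hφ measurable_prodMk_left, smul_eq_mul]

lemma isProbabilityMeasure_mix {w : Fin K → ℝ≥0} (hw : ∑ c, w c = 1) (μ : Fin K → Measure X)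
    [∀ c, IsProbabilityMeasure (μ c)] : IsProbabilityMeasure (mix w μ) := by
  constructor
  have := lintegral_mix w μ (φ := fun _ => 1) measurable_const
  simp only [lintegral_const, one_mul, measure_univ, mul_one] at this
  rw [this]
  exact_mod_cast hw

lemma integrable_mix {w : Fin K → ℝ≥0} {μ : Fin K → Measure X} [∀ c, SFinite (μ c)]
    {g : Fin K × X → ℝ} (hg : Measurable g) (h : ∀ c, Integrable (fun x => g (c, x)) (μ c)) :
    Integrable g (mix w μ) := by
  rw [mix_eq, integrable_finsetSum_measure]
  intro c _
  refine Integrable.smul_measure ?_ ENNReal.coe_ne_top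
  exact (integrable_map_measure hg.aestronglyMeasurable measurable_prodMk_left.aemeasurable).2 (h c)

lemma integral_mix {w : Fin K → ℝ≥0} {μ : Fin K → Measure X} [∀ c, SFinite (μ c)]
    {g : Fin K × X → ℝ} (hg : Measurable g) (h : ∀ c, Integrable (fun x => g (c, x)) (μ c)) :
    ∫ z, g z ∂(mix w μ) = ∑ c, (w c : ℝ) * ∫ x, g (c, x) ∂(μ c) := by
  rw [mix_eq, integral_finsetSum_measure]
  · refine Finset.sum_congr rfl fun c _ => ?_
    rw [integral_smul_measure, integral_map measurable_prodMk_left.aemeasurable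
      hg.aestronglyMeasurable]
    simp
  · intro c _
    refine Integrable.smul_measure ?_ ENNReal.coe_ne_top
    exact (integrable_map_measure hg.aestronglyMeasurable
      measurable_prodMk_left.aemeasurable).2 (h c)

lemma memLp_two_mix {w : Fin K → ℝ≥0} {μ : Fin K → Measure X} [∀ c, SFinite (μ c)]
    {g : Fin K × X → ℝ} (hg : Measurable g) (h : ∀ c, MemLp (fun x => g (c, x)) 2 (μ c)) :
    MemLp g 2 (mix w μ) := by
  rw [memLp_two_iff_integrable_sq hg.aestronglyMeasurable]
  exact integrable_mix (by fun_prop) fun c => (h c).integrable_sq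

/-- A reproduction letter here is a strategy: one reproduction for each state, with independent
coordinates. Cost and density see only the coordinate of the actual state, and the others integrate
out. Coding with the state at both terminals thereby becomes ordinary coding of the pair (C, h). -/
lemma MatchedPair.mix {w : Fin K → ℝ≥0} (hw : ∑ c, w c = 1) {μ : Fin K → Measure X}
    {ν : Fin K → Measure Y} {A : Fin K → X → ℝ} {q : Fin K → X × Y → ℝ} {Λ Δ : Fin K → ℝ}
    (h : ∀ c, MatchedPair (μ c) (ν c) (A c) (q c) (Λ c) (Δ c)) :
    MatchedPair (mix w μ) (Measure.pi ν) (fun z => A z.1 z.2)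
      (fun z => q z.1.1 (z.1.2, z.2 z.1.1)) (∑ c, w c * Λ c) (∑ c, w c * Δ c) := by
  have := fun c => (h c).prob_left
  have := fun c => (h c).prob_right
  have := fun c => (h c).isProbabilityMeasure_coupling
  have := isProbabilityMeasure_mix hw μ
  have hA := fun c => (h c).measurable_potential
  have hq := fun c => (h c).measurable_cost
  have hAm : Measurable fun z : Fin K × X => A z.1 z.2 := measurable_from_prod_countable_right hA
  have hqm' : Measurable fun z : Fin K × (X × Y) => q z.1 z.2 :=
    measurable_from_prod_countable_right hq
  have hev : Measurable fun z : Fin K × (Fin K → Y) => z.2 z.1 :=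
    measurable_from_prod_countable_right fun c => measurable_pi_apply c
  have hs : Measurable fun z : (Fin K × X) × (Fin K → Y) => (z.1.1, (z.1.2, z.2 z.1.1)) := by
    have : Measurable fun z : (Fin K × X) × (Fin K → Y) => z.2 z.1.1 :=
      hev.comp (show Measurable fun z : (Fin K × X) × (Fin K → Y) => (z.1.1, z.2) by fun_prop)
    fun_prop
  have hqm : Measurable fun z : (Fin K × X) × (Fin K → Y) => q z.1.1 (z.1.2, z.2 z.1.1) :=
    hqm'.comp hs
  -- Once the unused coordinates are forgotten, the coupling is the mixture of the couplings of the
  -- states; the marginal and the cost are read off from this.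
  have hc : (coupling (CSI.mix w μ) (Measure.pi ν) (fun z => A z.1 z.2)
      (fun z => q z.1.1 (z.1.2, z.2 z.1.1))).map (fun z => (z.1.1, (z.1.2, z.2 z.1.1))) =
      CSI.mix w fun c => coupling (μ c) (ν c) (A c) (q c) := by
    refine Measure.ext_of_lintegral _ fun φ hφ => ?_
    have h1 := lintegral_coupling (μ := CSI.mix w μ) (ν := Measure.pi ν) hAm hqm (hφ.comp hs)
    simp only [Function.comp_apply] at h1
    rw [lintegral_map hφ hs, h1, lintegral_mix _ _ hφ, lintegral_mix]
    · refine Finset.sum_congr rfl fun c _ => ?_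
      rw [lintegral_coupling (hA c) (hq c) (by fun_prop)]
      congr 1
      refine lintegral_congr fun x => ?_
      exact (measurePreserving_eval ν c).lintegral_comp
        (f := fun y => ENNReal.ofReal (Real.exp (A c x - q c (x, y))) * φ (c, (x, y)))
        (by have := hq c; fun_prop)
    · exact Measurable.lintegral_prod_right (by fun_prop)
  have hmemq : MemLp (fun z : Fin K × (X × Y) => q z.1 z.2) 2
      (CSI.mix w fun c => coupling (μ c) (ν c) (A c) (q c)) :=
    memLp_two_mix hqm' fun c => (h c).memLp_cost
  refine ⟨this, inferInstance, hAm, hqm, memLp_two_mix hAm fun c => (h c).memLp_potential, ?_, ?_,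
    ?_, ?_, ?_, ?_⟩
  · rw [integral_mix hAm fun c => (h c).memLp_potential.integrable one_le_two]
    simp only [(h _).integral_potential]
  · intro y
    rw [lintegral_mix _ _ (by fun_prop)]
    calc _ ≤ ∑ c, (w c : ℝ≥0∞) * 1 := by
          gcongr with c
          exact (h c).dual_le_one (y c)
      _ = 1 := by simp only [mul_one]; exact_mod_cast hw
  · have h1 := congrArg (Measure.map fun z : Fin K × (X × Y) => (z.1, z.2.1)) hc
    rw [Measure.map_map (by fun_prop) hs] at h1
    refine h1.trans ?_
    refine Measure.ext_of_lintegral _ fun φ hφ => ?_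
    rw [lintegral_map hφ (by fun_prop), lintegral_mix _ _ (by fun_prop), lintegral_mix _ _ hφ]
    refine Finset.sum_congr rfl fun c _ => ?_
    conv_rhs => rw [← (h c).fst_coupling, Measure.fst, lintegral_map (by fun_prop) measurable_fst]
  · rw [← hc, memLp_map_measure_iff hqm'.aestronglyMeasurable hs.aemeasurable] at hmemq
    exact hmemq
  · have h1 := integral_map (μ := coupling (CSI.mix w μ) (Measure.pi ν) (fun z => A z.1 z.2)
      (fun z => q z.1.1 (z.1.2, z.2 z.1.1))) hs.aemeasurable hqm'.aestronglyMeasurable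
    rw [hc, integral_mix hqm' fun c => (h c).memLp_cost.integrable one_le_two] at h1
    refine h1.symm.trans ?_
    simp only [(h _).integral_cost]
  · choose y₀ hy₀ using fun c => (h c).exists_ref
    exact ⟨y₀, memLp_two_mix (by fun_prop) hy₀⟩

end Matched

/-! ### The Gaussian matched pairs -/

/-- The dual potential of a real Gaussian of variance `v` at water level `t`. -/
def gaussianPotential (v t : ℝ≥0) (x : ℝ) : ℝ := gain v t / 2 + x ^ 2 / (2 * max (v : ℝ) t)

lemma memLp_sq_gaussianReal (v : ℝ≥0) : MemLp (fun x : ℝ => x ^ 2) 2 (gaussianReal 0 v) := by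
  rw [memLp_two_iff_integrable_sq (by fun_prop)]
  have h : MemLp id (4 : ℕ) (gaussianReal 0 v) := memLp_id_gaussianReal 4
  refine (h.integrable_norm_pow (by norm_num)).congr (Eventually.of_forall fun x => ?_)
  simp only [id, Real.norm_eq_abs]
  rw [← pow_mul, Even.pow_abs (by decide)]

lemma integral_sq_gaussianReal (v : ℝ≥0) : ∫ x, x ^ 2 ∂(gaussianReal 0 v) = v := by
  have h := variance_fun_id_gaussianReal (μ := 0) (v := v)
  rw [variance_eq_sub (X := fun x : ℝ => x) (memLp_id_gaussianReal' 2 (by norm_num))] at h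
  simpa using h

/-- The law on the left is the backward channel given y. The ratio of the normalising constants is
√(v/t), which is exp(gain/2), and the quadratic terms match the exponent. -/
lemma gaussianReal_eq_withDensity_of_lt {v t : ℝ≥0} (ht : 0 < t) (h : t < v) (y : ℝ) :
    gaussianReal y t = (gaussianReal 0 v).withDensity fun x =>
      ENNReal.ofReal (Real.exp (gaussianPotential v t x - (x - y) ^ 2 / (2 * t))) := by
  have hv : 0 < v := ht.trans h
  have ht' : (0 : ℝ) < t := ht
  have hv' : (0 : ℝ) < v := hv
  have hvt : (t : ℝ) ≤ v := h.le
  rw [gaussianReal_of_var_ne_zero _ ht.ne', gaussianReal_of_var_ne_zero _ hv.ne',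
    ← withDensity_mul _ (measurable_gaussianPDF _ _) (by unfold gaussianPotential; fun_prop)]
  congr 1
  funext x
  simp only [Pi.mul_apply, gaussianPDF]
  rw [← ENNReal.ofReal_mul (gaussianPDFReal_nonneg _ _ _)]
  congr 1
  simp only [gaussianPDFReal, gaussianPotential, gain, max_eq_left hvt]
  have h1 : Real.exp (Real.log ((v : ℝ) / t) / 2) = Real.sqrt (v / t) := by
    rw [Real.sqrt_eq_rpow, Real.rpow_def_of_pos (by positivity)]
    congr 1; ring
  have h2 : Real.sqrt (2 * Real.pi * v) = Real.sqrt (2 * Real.pi * t) * Real.sqrt (v / t) := by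
    rw [← Real.sqrt_mul (by positivity)]
    congr 1; field_simp
  have h3 : Real.sqrt (v / t) ≠ 0 := by positivity
  have h4 : Real.sqrt (2 * Real.pi * t) ≠ 0 := by positivity
  rw [show Real.log ((v : ℝ) / t) / 2 + x ^ 2 / (2 * v) - (x - y) ^ 2 / (2 * t) =
    Real.log ((v : ℝ) / t) / 2 + (x ^ 2 / (2 * v) + -(x - y) ^ 2 / (2 * t)) by ring,
    Real.exp_add, Real.exp_add, h1, h2]
  have h5 : Real.exp (-(x - 0) ^ 2 / (2 * v)) * Real.exp (x ^ 2 / (2 * v)) = 1 := by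
    rw [← Real.exp_add, ← Real.exp_zero]
    congr 1; ring
  rw [mul_inv]
  calc (√(2 * Real.pi * t))⁻¹ * Real.exp (-(x - y) ^ 2 / (2 * t))
      = (√(2 * Real.pi * t))⁻¹ * ((√(v / t))⁻¹ * √(v / t)) *
        (Real.exp (-(x - 0) ^ 2 / (2 * v)) * Real.exp (x ^ 2 / (2 * v))) *
        Real.exp (-(x - y) ^ 2 / (2 * t)) := by
        rw [inv_mul_cancel₀ h3, h5]; ring
    _ = _ := by ring

/-- For t < v the integrand is a probability density. For t ≥ v the exponent is affine in x, and the
Gaussian moment generating function gives exp((v − t)y²/(2t²)) ≤ 1. -/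
lemma lintegral_exp_gaussianPotential_le_one {v t : ℝ≥0} (ht : 0 < t) (y : ℝ) :
    ∫⁻ x, ENNReal.ofReal (Real.exp (gaussianPotential v t x - (x - y) ^ 2 / (2 * t)))
      ∂(gaussianReal 0 v) ≤ 1 := by
  rcases lt_or_ge t v with h | h
  · have h1 := congrArg (fun m : Measure ℝ => m Set.univ)
      (gaussianReal_eq_withDensity_of_lt ht h y)
    simp only [measure_univ, withDensity_apply _ MeasurableSet.univ, Measure.restrict_univ] at h1
    exact h1.symm.le
  · have ht' : (0 : ℝ) < t := ht
    have hvt : (v : ℝ) ≤ t := h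
    have hexp : ∀ x : ℝ, gaussianPotential v t x - (x - y) ^ 2 / (2 * t) =
        y / t * x + -(y ^ 2 / (2 * t)) := fun x => by
      rw [gaussianPotential, gain_eq_zero ht h, max_eq_right hvt]
      field_simp
      ring
    simp only [hexp, Real.exp_add]
    rw [← ofReal_integral_eq_lintegral_ofReal]
    · rw [integral_mul_const]
      have := congrFun (mgf_id_gaussianReal (μ := 0) (v := v)) (y / t)
      simp only [mgf, id, zero_mul, zero_add] at this
      rw [this, ← Real.exp_add]
      refine ENNReal.ofReal_le_one.2 (Real.exp_le_one_iff.2 ?_)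
      have h2 : (v : ℝ) * (y / t) ^ 2 / 2 ≤ t * (y / t) ^ 2 / 2 := by gcongr
      have h3 : (t : ℝ) * (y / t) ^ 2 / 2 = y ^ 2 / (2 * t) := by field_simp
      linarith
    · exact (integrable_exp_mul_gaussianReal _).mul_const _
    · exact Eventually.of_forall fun x => by positivity

/-- Backward test channel: x = y + w with independent reproduction y and error w. For v ≤ t the
truncated `v - t` makes y a Dirac mass at 0 and the density equals 1 there: the mode is not coded.
-/
lemma coupling_gaussianReal {v t : ℝ≥0} (ht : 0 < t) :
    coupling (gaussianReal 0 v) (gaussianReal 0 (v - t)) (gaussianPotential v t)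
      (fun z => (z.1 - z.2) ^ 2 / (2 * t)) =
      ((gaussianReal 0 (v - t)).prod (gaussianReal 0 (min v t))).map
        (fun z => (z.1 + z.2, z.1)) := by
  have hA : Measurable (gaussianPotential v t) := by unfold gaussianPotential; fun_prop
  refine Measure.ext_of_lintegral _ fun φ hφ => ?_
  rw [lintegral_map hφ (by fun_prop), coupling,
    lintegral_withDensity_eq_lintegral_mul _ (by fun_prop) hφ,
    lintegral_prod_symm _ (by fun_prop), lintegral_prod _ (by fun_prop)]
  rcases lt_or_ge t v with h | h
  · refine lintegral_congr fun y => ?_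
    rw [min_eq_right h.le]
    have h1 := gaussianReal_map_const_add (μ := 0) (v := t) y
    rw [zero_add] at h1
    have h2 : ∫⁻ w, φ (y + w, y) ∂(gaussianReal 0 t) = ∫⁻ x, φ (x, y) ∂(gaussianReal y t) := by
      rw [← h1, lintegral_map (by fun_prop) (by fun_prop)]
    simp only
    rw [h2, gaussianReal_eq_withDensity_of_lt ht h y,
      lintegral_withDensity_eq_lintegral_mul _ (by fun_prop) (by fun_prop)]
    rfl
  · have ht' : (0 : ℝ) < t := ht
    have hvt : (v : ℝ) ≤ t := h
    rw [tsub_eq_zero_of_le h, gaussianReal_zero_var, lintegral_dirac, lintegral_dirac,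
      min_eq_left h]
    refine lintegral_congr fun x => ?_
    simp [gaussianPotential, gain_eq_zero ht h, max_eq_right hvt]

lemma matchedPair_gaussianReal (v : ℝ≥0) {t : ℝ≥0} (ht : 0 < t) :
    MatchedPair (gaussianReal 0 v) (gaussianReal 0 (v - t)) (gaussianPotential v t)
      (fun z => (z.1 - z.2) ^ 2 / (2 * t)) (lag v t / 2) (min (v : ℝ) t / t / 2) := by
  have ht' : (0 : ℝ) < t := ht
  have hA : Measurable (gaussianPotential v t) := by unfold gaussianPotential; fun_prop
  have hm : Measurable fun z : ℝ × ℝ => (z.1 + z.2, z.1) := by fun_prop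
  have hsq := memLp_sq_gaussianReal v
  have hw : MemLp (fun z : ℝ × ℝ => z.2 ^ 2 / (2 * t)) 2
      ((gaussianReal 0 (v - t)).prod (gaussianReal 0 (min v t))) := by
    have := ((memLp_sq_gaussianReal (min v t)).comp_measurePreserving
      (measurePreserving_snd (μ := gaussianReal 0 (v - t)))).mul_const (2 * (t : ℝ))⁻¹
    simpa [div_eq_mul_inv, Function.comp_def] using this
  refine ⟨inferInstance, inferInstance, hA, by fun_prop, ?_, ?_,
    lintegral_exp_gaussianPotential_le_one ht, ?_, ?_, ?_, ?_⟩
  · have := (memLp_const (p := 2) (μ := gaussianReal 0 v) (gain v t / 2)).add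
      (hsq.mul_const (2 * max (v : ℝ) t)⁻¹)
    simp only [← div_eq_mul_inv] at this
    exact this
  · unfold gaussianPotential
    rw [integral_add (integrable_const _) ((hsq.integrable one_le_two).div_const _),
      integral_div _ (fun x : ℝ => x ^ 2), integral_sq_gaussianReal, lag]
    simp only [integral_const, probReal_univ, one_smul]
    rcases le_total (v : ℝ) t with h | h
    · rw [max_eq_right h, min_eq_left h]; field_simp
    · rw [max_eq_left h, min_eq_right h]
      have : (0 : ℝ) < v := ht'.trans_le h
      field_simp
  · rw [coupling_gaussianReal ht, Measure.fst, Measure.map_map measurable_fst hm]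
    have := gaussianReal_conv_gaussianReal (m₁ := 0) (m₂ := 0) (v₁ := v - t) (v₂ := min v t)
    rw [Measure.conv] at this
    rw [tsub_add_min, add_zero] at this
    exact this
  · rw [coupling_gaussianReal ht, memLp_map_measure_iff
      (Measurable.aestronglyMeasurable (by fun_prop)) hm.aemeasurable]
    simpa [Function.comp_def] using hw
  · rw [coupling_gaussianReal ht, integral_map hm.aemeasurable
      (Measurable.aestronglyMeasurable (by fun_prop))]
    simp only [add_sub_cancel_left]
    rw [integral_div]
    have h2 : ∫ z, z.2 ^ 2 ∂((gaussianReal 0 (v - t)).prod (gaussianReal 0 (min v t))) =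
        ∫ x, x ^ 2 ∂(gaussianReal 0 (min v t)) := by
      simp [integral_fun_snd (f := fun x : ℝ => x ^ 2)]
    rw [h2, integral_sq_gaussianReal]
    simp only [NNReal.coe_min]
    field_simp
  · refine ⟨0, ?_⟩
    simpa [div_eq_mul_inv] using hsq.mul_const (2 * (t : ℝ))⁻¹

lemma gain_half (v : ℝ≥0) {θ : ℝ≥0} (hθ : 0 < θ) : gain (v / 2) (θ / 2) = gain v θ := by
  have hθ' : (0 : ℝ) < θ := hθ
  unfold gain
  push_cast
  rw [max_div_div_right zero_le_two, div_div_div_cancel_right₀ two_ne_zero]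

lemma lag_half (v : ℝ≥0) {θ : ℝ≥0} (hθ : 0 < θ) : lag (v / 2) (θ / 2) = lag v θ := by
  unfold lag
  rw [gain_half v hθ]
  push_cast
  rw [min_div_div_right zero_le_two, div_div_div_cancel_right₀ two_ne_zero]

lemma complexGaussian_eq_map_pi (v : ℝ≥0) :
    complexGaussian v = (Measure.pi fun _ : Fin 2 => gaussianReal 0 (v / 2)).map
      (MeasurableEquiv.finTwoArrow.trans Complex.measurableEquivRealProd.symm) := by
  rw [MeasurableEquiv.coe_trans, ← Measure.map_map (MeasurableEquiv.measurable _)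
    (MeasurableEquiv.measurable _), (measurePreserving_finTwoArrow _).map_eq]
  rfl

/-- Real and imaginary parts have variance v/2 and are taken at level θ/2. Halving both leaves `lag`
unchanged, each part carries half of it, and the costs (x − y)²/(2·θ/2) add up to the squared
modulus over θ. -/
lemma exists_matchedPair_complexGaussian (v : ℝ≥0) {θ : ℝ≥0} (hθ : 0 < θ) :
    ∃ (ν : Measure ℂ) (A : ℂ → ℝ), MatchedPair (complexGaussian v) ν A
      (fun z => ‖z.1 - z.2‖ ^ 2 / θ) (lag v θ) (min (v : ℝ) θ / θ) := by
  have hθ' : (0 : ℝ) < θ := hθ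
  have hθ2 : 0 < θ / 2 := by positivity
  have h := (MatchedPair.pi fun _ : Fin 2 => matchedPair_gaussianReal (v / 2) hθ2).map
    (MeasurableEquiv.finTwoArrow.trans Complex.measurableEquivRealProd.symm)
    (MeasurableEquiv.finTwoArrow.trans Complex.measurableEquivRealProd.symm)
    (q' := fun z : ℂ × ℂ => ‖z.1 - z.2‖ ^ 2 / θ) (by fun_prop) (fun x y => by
      simp [Complex.sq_norm, Complex.normSq_apply]
      field_simp)
  rw [← complexGaussian_eq_map_pi] at h
  simp only [Fin.sum_univ_two, lag_half v hθ, add_halves] at h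
  push_cast at h
  rw [min_div_div_right zero_le_two, div_div_div_cancel_right₀ two_ne_zero] at h
  exact ⟨_, _, h⟩

/-- The measurable automorphism of `ℂ^N` defined by a unitary matrix. -/
def unitaryEquiv {N : ℕ} (U : Matrix.unitaryGroup (Fin N) ℂ) : (Fin N → ℂ) ≃ᵐ Vec N where
  toFun x := WithLp.toLp 2 ((U : Matrix (Fin N) (Fin N) ℂ).mulVec x)
  invFun h := (star (U : Matrix (Fin N) (Fin N) ℂ)).mulVec (WithLp.ofLp h)
  left_inv x := by simp [Matrix.mulVec_mulVec]
  right_inv h := by simp [Matrix.mulVec_mulVec]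
  measurable_toFun := by
    change Measurable fun x => WithLp.toLp 2 ((U : Matrix (Fin N) (Fin N) ℂ).mulVec x)
    exact Continuous.measurable (by fun_prop)
  measurable_invFun := by
    change Measurable fun h : Vec N =>
      (star (U : Matrix (Fin N) (Fin N) ℂ)).mulVec (WithLp.ofLp h)
    exact Continuous.measurable (by fun_prop)

lemma norm_unitaryEquiv_sub {N : ℕ} (U : Matrix.unitaryGroup (Fin N) ℂ) (x y : Fin N → ℂ) :
    ‖unitaryEquiv U x - unitaryEquiv U y‖ ^ 2 = ∑ m, ‖x m - y m‖ ^ 2 := by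
  have h1 : unitaryEquiv U x - unitaryEquiv U y =
      WithLp.toLp 2 ((U : Matrix (Fin N) (Fin N) ℂ).mulVec (x - y)) := by
    rw [Matrix.mulVec_sub]; rfl
  have h2 : ∀ w : Fin N → ℂ, ((∑ m, ‖w m‖ ^ 2 : ℝ) : ℂ) = star w ⬝ᵥ w := fun w => by
    simp [dotProduct, Complex.conj_mul']
  have h3 : star (U : Matrix (Fin N) (Fin N) ℂ) * (U : Matrix (Fin N) (Fin N) ℂ) = 1 := by simp
  rw [h1, EuclideanSpace.norm_sq_eq]
  apply Complex.ofReal_injective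
  have h4 := h2 (x - y)
  simp only [Pi.sub_apply] at h4
  rw [h2, h4, Matrix.star_mulVec, Matrix.dotProduct_mulVec, Matrix.vecMul_vecMul,
    ← Matrix.star_eq_conjTranspose, h3, Matrix.vecMul_one]

/-- A product over the eigenmodes, then the rotation by the eigenvector matrix, which is an isometry
and so preserves the form of the cost. -/
lemma exists_matchedPair_complexGaussianVec {N : ℕ} {R : Matrix (Fin N) (Fin N) ℂ}
    (hR : R.PosSemidef) {θ : ℝ≥0} (hθ : 0 < θ) :
    ∃ (ν : Measure (Vec N)) (A : Vec N → ℝ), MatchedPair (complexGaussianVec hR) ν A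
      (fun z => ‖z.1 - z.2‖ ^ 2 / θ) (∑ m, lag (spectrumOf hR m) θ)
      (∑ m, min (spectrumOf hR m : ℝ) θ / θ) := by
  choose ν A h using fun m => exists_matchedPair_complexGaussian (spectrumOf hR m) hθ
  have h' := (MatchedPair.pi h).map (unitaryEquiv hR.isHermitian.eigenvectorUnitary)
    (unitaryEquiv hR.isHermitian.eigenvectorUnitary)
    (q' := fun z : Vec N × Vec N => ‖z.1 - z.2‖ ^ 2 / θ) (by fun_prop) (fun x y => by
      simp only
      rw [norm_unitaryEquiv_sub, Finset.sum_div])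
  exact ⟨_, _, h'⟩

/-! ### Single-letter rate-distortion functions -/

section Mixtures

variable {X Y : Type*} [MeasurableSpace X] [MeasurableSpace Y] {K : ℕ}

/-- Averaging dual potentials with the posterior probabilities of the states gives a dual potential
for the mixture law. -/
lemma exists_mixture_potential {w : Fin K → ℝ≥0} (hw : ∑ c, w c = 1) {μ : Fin K → Measure X}
    [∀ c, IsProbabilityMeasure (μ c)] {A : Fin K → X → ℝ} (hA : ∀ c, Measurable (A c))
    (hAi : ∀ c, Integrable (A c) (μ c)) {q : X × Y → ℝ} (hq : Measurable q)
    (h : ∀ c y, ∫⁻ x, ENNReal.ofReal (Real.exp (A c x - q (x, y))) ∂(μ c) ≤ 1) :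
    ∃ B : X → ℝ, Measurable B ∧ Integrable B (∑ c, (w c : ℝ≥0∞) • μ c) ∧
      ∫ x, B x ∂(∑ c, (w c : ℝ≥0∞) • μ c) = ∑ c, (w c : ℝ) * ∫ x, A c x ∂(μ c) ∧
      ∀ y, ∫⁻ x, ENNReal.ofReal (Real.exp (B x - q (x, y))) ∂(∑ c, (w c : ℝ≥0∞) • μ c) ≤ 1 := by
  set M : Measure X := ∑ c, (w c : ℝ≥0∞) • μ c with hM
  have hprob : IsProbabilityMeasure M := ⟨by
    simp only [hM, Measure.coe_finsetSum, Finset.sum_apply, Measure.smul_apply, measure_univ,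
      smul_eq_mul, mul_one]
    exact_mod_cast hw⟩
  have hfin : ∀ c, IsFiniteMeasure ((w c : ℝ≥0∞) • μ c) := fun c =>
    (μ c).smul_finite ENNReal.coe_ne_top
  have hac : ∀ c, ((w c : ℝ≥0∞) • μ c) ≪ M := fun c => by
    refine Measure.absolutelyContinuous_of_le (Measure.le_iff.2 fun s _ => ?_)
    simp only [hM, Measure.coe_finsetSum, Finset.sum_apply]
    exact Finset.single_le_sum (f := fun c => ((w c : ℝ≥0∞) • μ c) s) (fun _ _ => zero_le)
      (Finset.mem_univ c)
  -- The posterior probability of state c given x.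
  set p : Fin K → X → ℝ≥0∞ := fun c => ((w c : ℝ≥0∞) • μ c).rnDeriv M with hp
  have hpm : ∀ c, Measurable (p c) := fun c => Measure.measurable_rnDeriv _ _
  have hpsum : ∀ᵐ x ∂M, ∑ c, p c x = 1 := by
    have h1 : M.withDensity (∑ c, p c) = M.withDensity 1 := by
      rw [withDensity_one]
      refine Measure.ext fun s hs => ?_
      rw [withDensity_apply _ hs]
      simp only [Finset.sum_apply]
      rw [lintegral_finsetSum _ fun c _ => hpm c]
      conv_rhs => rw [hM, Measure.coe_finsetSum, Finset.sum_apply]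
      refine Finset.sum_congr rfl fun c _ => ?_
      rw [← withDensity_apply _ hs, hp, Measure.withDensity_rnDeriv_eq _ _ (hac c)]
    have h2 := (withDensity_eq_iff (by fun_prop) (by fun_prop) (by
      simp only [Finset.sum_apply]
      rw [lintegral_finsetSum _ fun c _ => hpm c]
      refine ENNReal.sum_ne_top.2 fun c _ => ?_
      exact (Measure.lintegral_rnDeriv_lt_top _ _).ne)).1 h1
    filter_upwards [h2] with x hx
    simpa using hx
  have hptop : ∀ᵐ x ∂M, ∀ c, p c x < ∞ :=
    ae_all_iff.2 fun c => Measure.rnDeriv_lt_top _ _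
  have hint : ∀ c, Integrable (fun x => (p c x).toReal * A c x) M := fun c =>
    (integrable_rnDeriv_smul_iff (hac c)).2 ((hAi c).smul_measure ENNReal.coe_ne_top)
  refine ⟨fun x => ∑ c, (p c x).toReal * A c x, by fun_prop, integrable_finsetSum _ fun c _ =>
    hint c, ?_, fun y => ?_⟩
  · rw [integral_finsetSum _ fun c _ => hint c]
    refine Finset.sum_congr rfl fun c _ => ?_
    have := integral_rnDeriv_smul (hac c) (f := A c)
    simp only [smul_eq_mul] at this
    rw [this, integral_smul_measure]
    simp
  · calc _ ≤ ∫⁻ x, ∑ c, p c x * ENNReal.ofReal (Real.exp (A c x - q (x, y))) ∂M := by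
          refine lintegral_mono_ae ?_
          filter_upwards [hpsum, hptop] with x h1 h2
          have h3 : ∑ c, (p c x).toReal = 1 := by
            rw [← ENNReal.toReal_sum fun c _ => (h2 c).ne, h1, ENNReal.toReal_one]
          -- Jensen with the posterior weights: q does not depend on the state, so averaging the
          -- potentials averages the whole exponent.
          have h4 := convexOn_exp.map_sum_le (t := Finset.univ) (w := fun c => (p c x).toReal)
            (p := fun c => A c x - q (x, y)) (fun _ _ => ENNReal.toReal_nonneg) h3
            (fun _ _ => Set.mem_univ _)
          simp only [smul_eq_mul, mul_sub, Finset.sum_sub_distrib, ← Finset.sum_mul, h3,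
            one_mul] at h4
          refine (ENNReal.ofReal_le_ofReal h4).trans ?_
          rw [ENNReal.ofReal_sum_of_nonneg fun c _ => by positivity]
          refine Finset.sum_le_sum fun c _ => ?_
          rw [ENNReal.ofReal_mul ENNReal.toReal_nonneg, ENNReal.ofReal_toReal (h2 c).ne]
      _ = ∑ c, (w c : ℝ≥0∞) * ∫⁻ x, ENNReal.ofReal (Real.exp (A c x - q (x, y))) ∂(μ c) := by
          rw [lintegral_finsetSum _ fun c _ => by have := hA c; fun_prop]
          refine Finset.sum_congr rfl fun c _ => ?_
          have := hA c
          rw [hp, lintegral_rnDeriv_mul (hac c) (by fun_prop), lintegral_smul_measure, smul_eq_mul]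
      _ ≤ ∑ c, (w c : ℝ≥0∞) * 1 := by
          gcongr with c
          exact h c y
      _ = 1 := by simp only [mul_one]; exact_mod_cast hw

lemma lintegral_mix_compProd (w : Fin K → ℝ≥0) (μ : Fin K → Measure X)
    [∀ c, SFinite (μ c)] [SFinite (mix w μ)] (κ : Kernel (Fin K × X) Y) [IsSFiniteKernel κ]
    {φ : (Fin K × X) × Y → ℝ≥0∞} (hφ : Measurable φ) :
    ∫⁻ z, φ z ∂(mix w μ ⊗ₘ κ) = ∑ c, (w c : ℝ≥0∞) *
      ∫⁻ z, φ ((c, z.1), z.2) ∂(μ c ⊗ₘ κ.comap (Prod.mk c) measurable_prodMk_left) := by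
  rw [Measure.lintegral_compProd hφ, lintegral_mix _ _ (by fun_prop)]
  refine Finset.sum_congr rfl fun c _ => ?_
  rw [Measure.lintegral_compProd (by fun_prop)]
  rfl

lemma condMutualInfo_mix_compProd {w : Fin K → ℝ≥0} (hw0 : ∀ c, 0 < w c) (hw : ∑ c, w c = 1)
    (μ : Fin K → Measure X) [∀ c, IsProbabilityMeasure (μ c)] (κ : Kernel (Fin K × X) Y)
    [IsMarkovKernel κ] :
    condMutualInfo (mix w μ ⊗ₘ κ) = ∑ c, (w c : ℝ≥0∞) *
      mutualInfo (μ c ⊗ₘ κ.comap (Prod.mk c) measurable_prodMk_left) := by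
  have := isProbabilityMeasure_mix hw μ
  unfold condMutualInfo
  refine Finset.sum_congr rfl fun c _ => ?_
  set s : Set ((Fin K × X) × Y) := {z | z.1.1 = c} with hs
  have hsm : MeasurableSet s := by
    have : Measurable fun z : (Fin K × X) × Y => z.1.1 := by fun_prop
    exact this (measurableSet_singleton c)
  have key : ∀ φ : X × Y → ℝ≥0∞, Measurable φ →
      ∫⁻ z in s, φ (z.1.2, z.2) ∂(mix w μ ⊗ₘ κ) =
        w c * ∫⁻ z, φ z ∂(μ c ⊗ₘ κ.comap (Prod.mk c) measurable_prodMk_left) := by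
    intro φ hφ
    rw [← lintegral_indicator hsm, lintegral_mix_compProd _ _ _
      (Measurable.indicator (by fun_prop) hsm), Finset.sum_eq_single c]
    · simp [s, Set.indicator]
    · intro c' _ hc'
      simp [s, Set.indicator, hc']
    · simp
  have hmass : (mix w μ ⊗ₘ κ) s = w c := by
    have := key 1 measurable_one
    simpa using this
  rw [hmass]
  congr 2
  refine Measure.ext_of_lintegral _ fun φ hφ => ?_
  rw [lintegral_map hφ (by fun_prop), ProbabilityTheory.cond, lintegral_smul_measure, key φ hφ,
    hmass, smul_eq_mul, ← mul_assoc, ENNReal.inv_mul_cancel (by simpa using (hw0 c).ne')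
    ENNReal.coe_ne_top, one_mul]

end Mixtures

lemma integrable_of_lintegral_enorm_sq {Ω E : Type*} [MeasurableSpace Ω] [NormedAddCommGroup E]
    [MeasurableSpace E] [BorelSpace E] {P : Measure Ω} {f : Ω → E} (hf : Measurable f)
    (h : ∫⁻ ω, ‖f ω‖ₑ ^ 2 ∂P ≠ ∞) : Integrable (fun ω => ‖f ω‖ ^ 2) P := by
  refine ⟨(by fun_prop : Measurable _).aestronglyMeasurable, ?_⟩
  rw [hasFiniteIntegral_iff_ofReal (Eventually.of_forall fun _ => by positivity)]
  refine lt_of_eq_of_lt ?_ (lt_top_iff_ne_top.2 h)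
  refine lintegral_congr fun ω => ?_
  rw [ENNReal.ofReal_pow (norm_nonneg _), ofReal_norm]

lemma integral_norm_sq_eq_toReal {Ω E : Type*} [MeasurableSpace Ω] [NormedAddCommGroup E]
    [MeasurableSpace E] [BorelSpace E] {P : Measure Ω} {f : Ω → E} (hf : Measurable f) :
    ∫ ω, ‖f ω‖ ^ 2 ∂P = (∫⁻ ω, ‖f ω‖ₑ ^ 2 ∂P).toReal := by
  rw [integral_eq_lintegral_of_nonneg_ae (Eventually.of_forall fun _ => by positivity)
    (by fun_prop : Measurable _).aestronglyMeasurable]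
  congr 1
  refine lintegral_congr fun ω => ?_
  rw [ENNReal.ofReal_pow (norm_nonneg _), ofReal_norm]

/-- The disintegrations of the `ρ c` glue to one kernel; measurability in the state is free because
there are finitely many states. -/
lemma exists_kernel_of_fst {X Y : Type*} [MeasurableSpace X] [MeasurableSpace Y]
    [StandardBorelSpace Y] [Nonempty Y] {K : ℕ} {μ : Fin K → Measure X}
    {ρ : Fin K → Measure (X × Y)} [∀ c, IsProbabilityMeasure (ρ c)] (h : ∀ c, (ρ c).fst = μ c) :
    ∃ κ : Kernel (Fin K × X) Y, IsMarkovKernel κ ∧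
      ∀ c, μ c ⊗ₘ κ.comap (Prod.mk c) measurable_prodMk_left = ρ c := by
  let κ : Kernel (Fin K × X) Y :=
    ⟨fun z => (ρ z.1).condKernel z.2,
      measurable_from_prod_countable_right fun c => (ρ c).condKernel.measurable⟩
  refine ⟨κ, ⟨fun z => inferInstanceAs (IsProbabilityMeasure ((ρ z.1).condKernel z.2))⟩,
    fun c => ?_⟩
  have h3 : κ.comap (Prod.mk c) measurable_prodMk_left = (ρ c).condKernel := by
    ext x : 1
    rfl
  rw [h3, ← h c]
  exact (ρ c).disintegrate (ρ c).condKernel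

/-- The marginals are μ and ν, so A − q is the log-density against the product of the marginals. -/
lemma MatchedPair.mutualInfo_coupling {X Y : Type*} [MeasurableSpace X] [MeasurableSpace Y]
    {μ : Measure X} {ν : Measure Y} {A : X → ℝ} {q : X × Y → ℝ} {Λ Δ : ℝ}
    (h : MatchedPair μ ν A q Λ Δ) :
    mutualInfo (coupling μ ν A q) = ENNReal.ofReal ((Λ - Δ) / Real.log 2) := by
  have := h.prob_left
  have := h.isProbabilityMeasure_coupling
  have hA := h.measurable_potential
  have hq := h.measurable_cost
  have hAi : Integrable (fun z : X × Y => A z.1) (coupling μ ν A q) := by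
    refine (integrable_map_measure (g := A) (f := Prod.fst) hA.aestronglyMeasurable
      measurable_fst.aemeasurable).1 ?_
    change Integrable A (coupling μ ν A q).fst
    rw [h.fst_coupling]
    exact h.memLp_potential.integrable one_le_two
  have hAint : ∫ z, A z.1 ∂(coupling μ ν A q) = Λ := by
    rw [← h.integral_potential]
    conv_rhs => rw [← h.fst_coupling]
    exact (integral_map measurable_fst.aemeasurable hA.aestronglyMeasurable).symm
  have hqi := h.memLp_cost.integrable one_le_two
  rw [mutualInfo_eq (F := fun z => A z.1 - q z) (by fun_prop) ?_ (hAi.sub hqi),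
    integral_sub hAi hqi, hAint, h.integral_cost]
  rw [h.fst_coupling, h.snd_coupling]
  rfl

lemma MatchedPair.lintegral_enorm_sq {N : ℕ} {μ ν : Measure (Vec N)} {A : Vec N → ℝ} {Λ Δ : ℝ}
    {θ : ℝ≥0} (hθ : 0 < θ)
    (h : MatchedPair μ ν A (fun z => ‖z.1 - z.2‖ ^ 2 / θ) Λ Δ) :
    ∫⁻ z, ‖z.1 - z.2‖ₑ ^ 2 ∂(coupling μ ν A (fun z => ‖z.1 - z.2‖ ^ 2 / θ)) =
      ENNReal.ofReal (θ * Δ) := by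
  have hθ' : (0 : ℝ) < θ := hθ
  have := h.isProbabilityMeasure_coupling
  have hi := h.memLp_cost.integrable one_le_two
  have h4 : ∀ z : Vec N × Vec N, ‖z.1 - z.2‖ₑ ^ 2 =
      ENNReal.ofReal (θ * (‖z.1 - z.2‖ ^ 2 / θ)) := fun z => by
    rw [mul_div_cancel₀ _ hθ'.ne', ENNReal.ofReal_pow (norm_nonneg _), ofReal_norm]
  simp only [h4]
  rw [← ofReal_integral_eq_lintegral_ofReal (hi.const_mul _)
    (Eventually.of_forall fun z => by positivity), integral_const_mul, h.integral_cost]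

/-! ### Information rate-distortion functions of the Gaussian mixture. -/

namespace GaussianMixture

variable {N K : ℕ} (S : GaussianMixture N K)

lemma jointLaw_eq_mix : S.jointLaw = mix S.weight S.component := rfl

lemma exists_matchedPair {θ : ℝ≥0} (hθ : 0 < θ) :
    ∃ (ν : Fin K → Measure (Vec N)) (A : Fin K → Vec N → ℝ), ∀ c,
      MatchedPair (S.component c) (ν c) (A c) (fun z => ‖z.1 - z.2‖ ^ 2 / θ)
        (∑ m, lag (S.eig c m) θ) (∑ m, min (S.eig c m : ℝ) θ / θ) := by
  choose ν A h using fun c => exists_matchedPair_complexGaussianVec (S.cov_posSemidef c) hθ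
  exact ⟨ν, A, h⟩

instance isProbabilityMeasure_component (c : Fin K) : IsProbabilityMeasure (S.component c) := by
  obtain ⟨ν, A, h⟩ := S.exists_matchedPair one_pos
  exact (h c).prob_left

instance isProbabilityMeasure_jointLaw : IsProbabilityMeasure S.jointLaw :=
  isProbabilityMeasure_mix S.weight_sum S.component

lemma map_snd_jointLaw : S.jointLaw.map Prod.snd = S.law := by
  refine Measure.ext_of_lintegral _ fun φ hφ => ?_
  rw [lintegral_map hφ measurable_snd, jointLaw_eq_mix, lintegral_mix _ _ (by fun_prop), law,
    lintegral_finsetSum_measure]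
  simp only [lintegral_smul_measure, smul_eq_mul]

instance isProbabilityMeasure_law : IsProbabilityMeasure S.law := by
  rw [← S.map_snd_jointLaw]
  exact Measure.isProbabilityMeasure_map measurable_snd.aemeasurable

/-- The certificate of state c bounds its information by an affine function of its distortion with
the common slope −1/θ, so only the average distortion survives averaging over states. -/
lemma Rcond_le_condInfoRD (hN : 0 < N) (D : ℝ≥0) : S.Rcond D ≤ condInfoRD S.jointLaw D := by
  have hN' : (0 : ℝ) < N := by exact_mod_cast hN
  have hNe : (N : ℝ≥0∞) ≠ 0 := by exact_mod_cast hN.ne'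
  have h2 : 0 < Real.log 2 := Real.log_pos one_lt_two
  refine S.Rcond_le_of_forall hN fun θ hθ => le_iInf fun κ => le_iInf fun hκ => le_iInf fun hD => ?_
  have hθ' : (0 : ℝ) < θ := hθ
  obtain ⟨ν, A, h⟩ := S.exists_matchedPair hθ
  have := isProbabilityMeasure_mix S.weight_sum S.component
  rw [ENNReal.inv_mul_le_iff hNe (ENNReal.natCast_ne_top _), jointLaw_eq_mix,
    lintegral_mix_compProd _ _ _ (by fun_prop)] at hD
  rw [jointLaw_eq_mix, condMutualInfo_mix_compProd S.weight_pos S.weight_sum]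
  set ρ : Fin K → Measure (Vec N × Vec N) := fun c =>
    S.component c ⊗ₘ κ.comap (Prod.mk c) measurable_prodMk_left with hρ
  change ∑ c, (S.weight c : ℝ≥0∞) * ∫⁻ z, ‖z.1 - z.2‖ₑ ^ 2 ∂(ρ c) ≤ _ at hD
  change _ ≤ (N : ℝ≥0∞)⁻¹ * ∑ c, (S.weight c : ℝ≥0∞) * mutualInfo (ρ c)
  have hfst : ∀ c, (ρ c).fst = S.component c := fun c => Measure.fst_compProd _ _
  have hprob : ∀ c, IsProbabilityMeasure (ρ c) := fun c => isProbabilityMeasure_of_fst (hfst c)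
  have hsub : Measurable fun z : Vec N × Vec N => z.1 - z.2 := by fun_prop
  have hsum_top : ∑ c, (S.weight c : ℝ≥0∞) * ∫⁻ z, ‖z.1 - z.2‖ₑ ^ 2 ∂(ρ c) ≠ ∞ :=
    ne_top_of_le_ne_top (by finiteness) hD
  have hfin : ∀ c, ∫⁻ z, ‖z.1 - z.2‖ₑ ^ 2 ∂(ρ c) ≠ ∞ := fun c hc => by
    have := ENNReal.sum_ne_top.1 hsum_top c (Finset.mem_univ c)
    rw [hc, ENNReal.mul_top (by simpa using (S.weight_pos c).ne')] at this
    exact this rfl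
  have hint : ∀ c, Integrable (fun z : Vec N × Vec N => ‖z.1 - z.2‖ ^ 2) (ρ c) := fun c =>
    integrable_of_lintegral_enorm_sq hsub (hfin c)
  set e : Fin K → ℝ := fun c => ∫ z, ‖z.1 - z.2‖ ^ 2 ∂(ρ c) with he
  have hle : ∑ c, (S.weight c : ℝ) * e c ≤ N * D := by
    have := ENNReal.toReal_mono (by finiteness) hD
    rw [ENNReal.toReal_sum fun c hc => ENNReal.sum_ne_top.1 hsum_top c hc] at this
    simp only [ENNReal.toReal_mul, ENNReal.coe_toReal, ENNReal.toReal_natCast] at this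
    simpa only [he, integral_norm_sq_eq_toReal hsub] using this
  have hmi : ∀ c, ENNReal.ofReal ((∑ m, lag (S.eig c m) θ - e c / θ) / Real.log 2) ≤
      mutualInfo (ρ c) := fun c => by
    have := ofReal_le_mutualInfo (ρ := ρ c) (h c).measurable_potential (h c).measurable_cost
      (by rw [hfst c]; exact (h c).memLp_potential.integrable one_le_two)
      ((hint c).div_const _) (by rw [hfst c]; exact (h c).dual_le_one)
    rwa [hfst c, (h c).integral_potential, integral_div] at this
  calc ENNReal.ofReal ((S.meanLag θ - N * D / θ) / (N * Real.log 2))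
      ≤ (N : ℝ≥0∞)⁻¹ * ENNReal.ofReal (∑ c, (S.weight c : ℝ) *
          ((∑ m, lag (S.eig c m) θ - e c / θ) / Real.log 2)) := by
        have h3 : ∑ c, (S.weight c : ℝ) * ((∑ m, lag (S.eig c m) θ - e c / θ) / Real.log 2) =
            (S.meanLag θ - (∑ c, (S.weight c : ℝ) * e c) / θ) / Real.log 2 := by
          unfold meanLag
          rw [Finset.sum_div, ← Finset.sum_sub_distrib, Finset.sum_div]
          refine Finset.sum_congr rfl fun c _ => ?_
          ring
        rw [h3, ← ENNReal.ofReal_natCast, ← ENNReal.ofReal_inv_of_pos hN',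
          ← ENNReal.ofReal_mul (by positivity), mul_comm (N : ℝ) (Real.log 2), ← div_div,
          div_eq_inv_mul _ (N : ℝ)]
        gcongr
    _ ≤ (N : ℝ≥0∞)⁻¹ * ∑ c, (S.weight c : ℝ≥0∞) * mutualInfo (ρ c) := by
        gcongr
        refine (Finset.le_sum_of_subadditive _ ENNReal.ofReal_zero.le
          (fun x y => ENNReal.ofReal_add_le) _ _).trans (Finset.sum_le_sum fun c _ => ?_)
        rw [ENNReal.ofReal_mul (S.weight c).coe_nonneg, ENNReal.ofReal_coe_nnreal]
        gcongr
        exact hmi c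

/-- The posterior average of the potentials has mean `S.meanLag θ`, so a test channel that does not
see the state obeys the same dual bounds. -/
lemma Rcond_le_infoRD (hN : 0 < N) (D : ℝ≥0) : S.Rcond D ≤ infoRD S.law D := by
  have hN' : (0 : ℝ) < N := by exact_mod_cast hN
  have hNe : (N : ℝ≥0∞) ≠ 0 := by exact_mod_cast hN.ne'
  have h2 : 0 < Real.log 2 := Real.log_pos one_lt_two
  refine S.Rcond_le_of_forall hN fun θ hθ => le_iInf fun κ => le_iInf fun hκ => le_iInf fun hD => ?_
  have hθ' : (0 : ℝ) < θ := hθ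
  obtain ⟨ν, A, h⟩ := S.exists_matchedPair hθ
  obtain ⟨B, hB, hBi, hBint, hdual⟩ := exists_mixture_potential S.weight_sum
    (fun c => (h c).measurable_potential)
    (fun c => (h c).memLp_potential.integrable one_le_two)
    (q := fun z : Vec N × Vec N => ‖z.1 - z.2‖ ^ 2 / (θ : ℝ)) (by fun_prop)
    (fun c => (h c).dual_le_one)
  rw [ENNReal.inv_mul_le_iff hNe (ENNReal.natCast_ne_top _)] at hD
  have hfst : (S.law ⊗ₘ κ).fst = S.law := Measure.fst_compProd _ _
  have hsub : Measurable fun z : Vec N × Vec N => z.1 - z.2 := by fun_prop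
  have hint := integrable_of_lintegral_enorm_sq (P := S.law ⊗ₘ κ) hsub
    (ne_top_of_le_ne_top (by finiteness) hD)
  have hle : ∫ z, ‖z.1 - z.2‖ ^ 2 ∂(S.law ⊗ₘ κ) ≤ N * D := by
    have := ENNReal.toReal_mono (by finiteness) hD
    rw [← integral_norm_sq_eq_toReal hsub] at this
    simpa using this
  have hmi := ofReal_le_mutualInfo (ρ := S.law ⊗ₘ κ) hB
    (q := fun z : Vec N × Vec N => ‖z.1 - z.2‖ ^ 2 / (θ : ℝ)) (by fun_prop)
    (by rw [hfst]; exact hBi) (hint.div_const _) (by rw [hfst]; exact hdual)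
  have hBint' : ∫ x, B x ∂S.law = S.meanLag θ := by
    refine hBint.trans ?_
    simp only [(h _).integral_potential]
    rfl
  rw [hfst, hBint', integral_div] at hmi
  calc ENNReal.ofReal ((S.meanLag θ - N * D / θ) / (N * Real.log 2))
      ≤ (N : ℝ≥0∞)⁻¹ * ENNReal.ofReal
          ((S.meanLag θ - (∫ z, ‖z.1 - z.2‖ ^ 2 ∂(S.law ⊗ₘ κ)) / θ) / Real.log 2) := by
        rw [← ENNReal.ofReal_natCast, ← ENNReal.ofReal_inv_of_pos hN',
          ← ENNReal.ofReal_mul (by positivity), mul_comm (N : ℝ) (Real.log 2), ← div_div,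
          div_eq_inv_mul _ (N : ℝ)]
        gcongr
    _ ≤ (N : ℝ≥0∞)⁻¹ * mutualInfo (S.law ⊗ₘ κ) := by gcongr

/-- The couplings at a feasible level, disintegrated, form a test channel whose information in each
state is Lagrangian minus normalised distortion, that is, the gain. -/
lemma condInfoRD_le_Rcond (hN : 0 < N) (D : ℝ≥0) : condInfoRD S.jointLaw D ≤ S.Rcond D := by
  have hN' : (0 : ℝ) < N := by exact_mod_cast hN
  have hNe : (N : ℝ≥0∞) ≠ 0 := by exact_mod_cast hN.ne'
  have h2 : 0 < Real.log 2 := Real.log_pos one_lt_two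
  refine S.le_Rcond_of_forall hN fun θ hθ hD => ?_
  have hθ' : (0 : ℝ) < θ := hθ
  obtain ⟨ν, A, h⟩ := S.exists_matchedPair hθ
  have hprob := fun c => (h c).isProbabilityMeasure_coupling
  set ρ : Fin K → Measure (Vec N × Vec N) := fun c =>
    coupling (S.component c) (ν c) (A c) (fun z => ‖z.1 - z.2‖ ^ 2 / θ) with hρ
  obtain ⟨κ, hκ, hκc⟩ := exists_kernel_of_fst (fun c => (h c).fst_coupling)
  change ∀ c, S.component c ⊗ₘ κ.comap (Prod.mk c) measurable_prodMk_left = ρ c at hκc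
  have hsub : Measurable fun z : Vec N × Vec N => z.1 - z.2 := by fun_prop
  have hdist : ∀ c, ∫⁻ z, ‖z.1 - z.2‖ₑ ^ 2 ∂(ρ c) = N * (waterDistortion (S.eig c) θ : ℝ≥0) :=
    fun c => by
    rw [(h c).lintegral_enorm_sq hθ, ← ENNReal.ofReal_natCast, ← ENNReal.ofReal_coe_nnreal,
      ← ENNReal.ofReal_mul hN'.le, waterDistortion_coe, ← Finset.sum_div]
    congr 1
    field_simp
  have hmi : ∀ c, mutualInfo (ρ c) =
      ENNReal.ofReal ((∑ m, gain (S.eig c m) θ) / Real.log 2) := fun c => by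
    rw [(h c).mutualInfo_coupling, ← Finset.sum_sub_distrib]
    simp [lag]
  have := isProbabilityMeasure_mix S.weight_sum S.component
  refine (iInf_le_of_le κ <| iInf_le_of_le hκ <| iInf_le_of_le ?_ le_rfl).trans ?_
  · rw [ENNReal.inv_mul_le_iff hNe (ENNReal.natCast_ne_top _), jointLaw_eq_mix,
      lintegral_mix_compProd _ _ _ (by fun_prop)]
    simp only [hκc, hdist]
    calc ∑ c, (S.weight c : ℝ≥0∞) * (N * (waterDistortion (S.eig c) θ : ℝ≥0))
        = N * (S.meanDistortion θ : ℝ≥0) := by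
          unfold meanDistortion
          push_cast
          rw [Finset.mul_sum]
          exact Finset.sum_congr rfl fun c _ => by ring
      _ ≤ N * D := by gcongr
  · rw [jointLaw_eq_mix, condMutualInfo_mix_compProd S.weight_pos S.weight_sum]
    simp only [hκc, hmi]
    have hg : ∀ c, 0 ≤ (∑ m, gain (S.eig c m) θ) / Real.log 2 := fun c =>
      div_nonneg (Finset.sum_nonneg fun m _ => gain_nonneg _ hθ) h2.le
    have h5 : ∑ c, (S.weight c : ℝ≥0∞) * ENNReal.ofReal ((∑ m, gain (S.eig c m) θ) / Real.log 2) =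
        ENNReal.ofReal (S.meanGain θ / Real.log 2) := by
      unfold meanGain
      rw [Finset.sum_div, ENNReal.ofReal_sum_of_nonneg]
      · refine Finset.sum_congr rfl fun c _ => ?_
        rw [mul_div_assoc, ENNReal.ofReal_mul (S.weight c).coe_nonneg, ENNReal.ofReal_coe_nnreal]
      · intro c _
        rw [mul_div_assoc]
        exact mul_nonneg (S.weight c).coe_nonneg (hg c)
    rw [h5, ← ENNReal.ofReal_natCast, ← ENNReal.ofReal_inv_of_pos hN',
      ← ENNReal.ofReal_mul (by positivity), mul_comm (N : ℝ) (Real.log 2), ← div_div,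
      div_eq_inv_mul _ (N : ℝ)]

end GaussianMixture

/-! ### Converse coding theorem -/

lemma numMessages_pos (N n : ℕ) (R : ℝ≥0) : 0 < numMessages N n R :=
  Nat.floor_pos.2 (Real.one_le_rpow one_le_two (by positivity))

lemma log_numMessages_le (N n : ℕ) (R : ℝ≥0) :
    Real.log (numMessages N n R) ≤ n * N * R * Real.log 2 := by
  have h0 : (0 : ℝ) < numMessages N n R := by exact_mod_cast numMessages_pos N n R
  rw [← Real.log_rpow two_pos]
  exact Real.log_le_log h0 (Nat.floor_le (by positivity))

lemma measurable_blockError {Ω : Type*} [MeasurableSpace Ω] {N n : ℕ} {x y : Ω → Fin n → Vec N}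
    (hx : Measurable x) (hy : Measurable y) : Measurable fun ω => blockError (x ω) (y ω) := by
  have hxt := fun t => (measurable_pi_apply t).comp hx
  have hyt := fun t => (measurable_pi_apply t).comp hy
  simp only [Function.comp_def] at hxt hyt
  unfold blockError
  refine Measurable.div_const (Finset.measurable_sum _ fun t _ => ?_) _
  exact (((hxt t).sub (hyt t)).enorm).pow_const 2

section Converse

variable {X Y : Type*} [MeasurableSpace X] [MeasurableSpace Y] {K : ℕ}

/-- A code with `M` messages and side information collects at most the dual weight `M`. -/
lemma lintegral_code_le {w : Fin K → ℝ≥0} (hw : ∑ c, w c = 1) {μ : Fin K → Measure X}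
    [∀ c, IsProbabilityMeasure (μ c)] {A : Fin K → X → ℝ} {q : X × Y → ℝ}
    (hA : ∀ c, Measurable (A c)) (hq : Measurable q)
    (h : ∀ c y, ∫⁻ x, ENNReal.ofReal (Real.exp (A c x - q (x, y))) ∂(μ c) ≤ 1) {n M : ℕ}
    (f : (Fin n → Fin K × X) → Fin M) (g : Fin M → (Fin n → Fin K) → Fin n → Y) :
    ∫⁻ z, ENNReal.ofReal (Real.exp (∑ t, (A (z t).1 (z t).2 -
      q ((z t).2, g (f z) (fun t => (z t).1) t)))) ∂(Measure.pi fun _ : Fin n => mix w μ) ≤ M := by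
  have := isProbabilityMeasure_mix hw μ
  -- Freezing the message j and the state sequence c makes the reproduction constant, so the
  -- integrand factors over time. The actual term is one of the sum over all (j, c), and each
  -- message contributes at most the total probability of the state sequences.
  set φ : Fin M → (Fin n → Fin K) → Fin n → Fin K × X → ℝ≥0∞ := fun j c t z =>
    {z : Fin K × X | z.1 = c t}.indicator
      (fun z => ENNReal.ofReal (Real.exp (A (c t) z.2 - q (z.2, g j c t)))) z with hφ
  have hset : ∀ c : Fin K, MeasurableSet {z : Fin K × X | z.1 = c} := fun c =>
    measurable_fst (measurableSet_singleton c)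
  have hφm : ∀ j c t, Measurable (φ j c t) := fun j c t => by
    have := hA (c t)
    exact Measurable.indicator (by fun_prop) (hset _)
  have hφi : ∀ j c t, ∫⁻ z, φ j c t z ∂(mix w μ) ≤ w (c t) := fun j c t => by
    rw [lintegral_mix _ _ (hφm j c t), Finset.sum_eq_single (c t)]
    · simp only [hφ, Set.indicator, Set.mem_ofPred_eq, if_true]
      exact mul_le_of_le_one_right zero_le (h _ _)
    · intro c' _ hc'
      simp [hφ, Set.indicator, hc']
    · simp
  calc _ ≤ ∫⁻ z, ∑ j, ∑ c, ∏ t, φ j c t (z t) ∂(Measure.pi fun _ : Fin n => mix w μ) := by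
        refine lintegral_mono fun z => ?_
        refine le_trans (le_of_eq ?_) ((Finset.single_le_sum
          (f := fun c => ∏ t, φ (f z) c t (z t)) (fun _ _ => zero_le)
          (Finset.mem_univ fun t => (z t).1)).trans (Finset.single_le_sum
          (f := fun j => ∑ c, ∏ t, φ j c t (z t)) (fun _ _ => zero_le) (Finset.mem_univ (f z))))
        rw [Real.exp_sum, ENNReal.ofReal_prod_of_nonneg fun i _ => (Real.exp_pos _).le]
        refine Finset.prod_congr rfl fun t _ => ?_
        simp [hφ, Set.indicator]
    _ = ∑ j, ∑ c, ∏ t, ∫⁻ z, φ j c t z ∂(mix w μ) := by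
        have hm : ∀ j c, Measurable fun z : Fin n → Fin K × X => ∏ t, φ j c t (z t) :=
          fun j c => Finset.measurable_prod _ fun t _ => (hφm j c t).comp (measurable_pi_apply t)
        rw [lintegral_finsetSum _ fun j _ => Finset.measurable_sum _ fun c _ => hm j c]
        refine Finset.sum_congr rfl fun j _ => ?_
        rw [lintegral_finsetSum _ fun c _ => hm j c]
        exact Finset.sum_congr rfl fun c _ => lintegral_pi_prod _ (hφm j c)
    _ ≤ ∑ j : Fin M, ∑ c : Fin n → Fin K, ∏ t, (w (c t) : ℝ≥0∞) := by
        gcongr with j _ c _ t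
        exact hφi j c t
    _ = M := by
        have : ∑ c : Fin n → Fin K, ∏ t, (w (c t) : ℝ≥0∞) = 1 := by
          have h1 := Finset.prod_univ_sum (fun _ : Fin n => (Finset.univ : Finset (Fin K)))
            (fun _ c => (w c : ℝ≥0∞))
          rw [Fintype.piFinset_univ] at h1
          rw [← h1]
          have h2 : ∑ c, (w c : ℝ≥0∞) = 1 := by exact_mod_cast hw
          simp [h2]
        simp [this]

end Converse

/-! ### Converse bounds for codes on the Gaussian mixture. -/

namespace GaussianMixture

variable {N K : ℕ} (S : GaussianMixture N K)

/-- Let F be the block sum of potential minus cost. By `lintegral_code_le` exp F has mean at most M,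
hence F has mean at most log M, while the distortion constraint bounds this mean from below by the
left side. -/
lemma le_log_of_code (hN : 0 < N) {θ : ℝ≥0} (hθ : 0 < θ) {n M : ℕ} (hn : 0 < n) (hM : 0 < M)
    {f : (Fin n → Fin K × Vec N) → Fin M} (hf : Measurable f)
    (g : Fin M → (Fin n → Fin K) → Fin n → Vec N) {D : ℝ≥0}
    (hD : ∫⁻ z, blockError (fun t => (z t).2) (g (f z) fun t => (z t).1)
      ∂(Measure.pi fun _ : Fin n => S.jointLaw) ≤ D) :
    n * (S.meanLag θ - N * D / θ) ≤ Real.log M := by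
  have hN' : (0 : ℝ) < N := by exact_mod_cast hN
  have hn' : (0 : ℝ) < n := by exact_mod_cast hn
  have hM' : (0 : ℝ) < M := by exact_mod_cast hM
  have hθ' : (0 : ℝ) < θ := hθ
  have hne : ((n : ℝ≥0∞) * N) ≠ 0 := by
    simpa using ⟨hn.ne', hN.ne'⟩
  obtain ⟨ν, A, h⟩ := S.exists_matchedPair hθ
  have hA := fun c => (h c).measurable_potential
  set P : Measure (Fin n → Fin K × Vec N) := Measure.pi fun _ : Fin n => S.jointLaw with hP
  have hAm : Measurable fun z : Fin K × Vec N => A z.1 z.2 := measurable_from_prod_countable_right hA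
  have hAi : Integrable (fun z : Fin K × Vec N => A z.1 z.2) S.jointLaw :=
    integrable_mix hAm fun c => (h c).memLp_potential.integrable one_le_two
  have hAint : ∫ z, A z.1 z.2 ∂S.jointLaw = S.meanLag θ := by
    refine (integral_mix hAm fun c => (h c).memLp_potential.integrable one_le_two).trans ?_
    simp only [(h _).integral_potential]
    rfl
  have hAti : ∀ t, Integrable (fun z : Fin n → Fin K × Vec N => A (z t).1 (z t).2) P := fun t =>
    integrable_comp_eval (μ := fun _ : Fin n => S.jointLaw) (i := t) hAi
  set y : (Fin n → Fin K × Vec N) → Fin n → Vec N := fun z => g (f z) fun t => (z t).1 with hy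
  have hym : Measurable y := by
    have h1 : Measurable fun p : Fin M × (Fin n → Fin K) => g p.1 p.2 := measurable_of_countable _
    exact h1.comp (hf.prodMk (by fun_prop))
  have hyt : ∀ t, Measurable fun z => (z t).2 - y z t := fun t => by
    have := (measurable_pi_apply t).comp hym
    simp only [Function.comp_def] at this
    fun_prop
  have hsum : ∑ t, ∫⁻ z, ‖(z t).2 - y z t‖ₑ ^ 2 ∂P ≤ n * N * D := by
    rw [← lintegral_finsetSum _ fun t _ => by have := hyt t; fun_prop]
    have h1 : ∫⁻ z, blockError (fun t => (z t).2) (y z) ∂P =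
        (∫⁻ z, ∑ t, ‖(z t).2 - y z t‖ₑ ^ 2 ∂P) / (n * N) := by
      simp only [blockError, div_eq_mul_inv]
      rw [lintegral_mul_const]
      exact Finset.measurable_sum _ fun t _ => by have := hyt t; fun_prop
    have h2 := h1 ▸ hD
    rw [ENNReal.div_le_iff hne (by finiteness)] at h2
    exact h2.trans (le_of_eq (mul_comm _ _))
  have hsum_top : ∑ t, ∫⁻ z, ‖(z t).2 - y z t‖ₑ ^ 2 ∂P ≠ ∞ :=
    ne_top_of_le_ne_top (by finiteness) hsum
  have hfin := fun t => ENNReal.sum_ne_top.1 hsum_top t (Finset.mem_univ t)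
  have hei : ∀ t, Integrable (fun z => ‖(z t).2 - y z t‖ ^ 2) P := fun t =>
    integrable_of_lintegral_enorm_sq (hyt t) (hfin t)
  have hele : ∑ t, ∫ z, ‖(z t).2 - y z t‖ ^ 2 ∂P ≤ n * N * D := by
    have h1 := ENNReal.toReal_mono (by finiteness) hsum
    rw [ENNReal.toReal_sum fun t _ => hfin t] at h1
    simp only [integral_norm_sq_eq_toReal (hyt _)]
    simpa using h1
  set F : (Fin n → Fin K × Vec N) → ℝ := fun z =>
    ∑ t, (A (z t).1 (z t).2 - ‖(z t).2 - y z t‖ ^ 2 / θ) with hF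
  have hFti : ∀ t, Integrable (fun z : Fin n → Fin K × Vec N =>
      A (z t).1 (z t).2 - ‖(z t).2 - y z t‖ ^ 2 / θ) P := fun t =>
    (hAti t).sub ((hei t).div_const _)
  have hFi : Integrable F P := integrable_finsetSum _ fun t _ => hFti t
  have hFint : n * (S.meanLag θ - N * D / θ) ≤ ∫ z, F z ∂P := by
    rw [hF, integral_finsetSum _ fun t _ => hFti t]
    have h1 : ∀ t, ∫ z, (A (z t).1 (z t).2 - ‖(z t).2 - y z t‖ ^ 2 / θ) ∂P =
        S.meanLag θ - (∫ z, ‖(z t).2 - y z t‖ ^ 2 ∂P) / θ := fun t => by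
      rw [integral_sub (hAti t) ((hei t).div_const _), integral_div]
      congr 1
      rw [← hAint]
      exact integral_comp_eval (μ := fun _ : Fin n => S.jointLaw) (i := t) hAm.aestronglyMeasurable
    simp only [h1, Finset.sum_sub_distrib, ← Finset.sum_div]
    have h2 : (∑ t, ∫ z, ‖(z t).2 - y z t‖ ^ 2 ∂P) / θ ≤ n * N * D / θ := by gcongr
    simp only [Finset.sum_const, Finset.card_univ, Fintype.card_fin, nsmul_eq_mul]
    have h3 : (n : ℝ) * (S.meanLag θ - N * D / θ) = n * S.meanLag θ - n * N * D / θ := by ring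
    linarith
  have hcode := lintegral_code_le S.weight_sum hA
    (q := fun z : Vec N × Vec N => ‖z.1 - z.2‖ ^ 2 / (θ : ℝ)) (by fun_prop)
    (fun c => (h c).dual_le_one) f g
  have hJ := integral_nonpos_of_lintegral_exp_le_one (P := P)
    (F := fun z => F z - Real.log M) (hFi.sub (integrable_const _)) (by
      have h1 : ∀ z, ENNReal.ofReal (Real.exp (F z - Real.log M)) =
          ENNReal.ofReal (Real.exp (F z)) * (M : ℝ≥0∞)⁻¹ := fun z => by
        rw [Real.exp_sub, Real.exp_log hM', ENNReal.ofReal_div_of_pos hM', div_eq_mul_inv,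
          ENNReal.ofReal_natCast]
      simp only [h1]
      rw [lintegral_mul_const' _ _ (by simpa using hM.ne'), ← div_eq_mul_inv]
      refine ENNReal.div_le_of_le_mul ?_
      rw [one_mul]
      exact hcode)
  rw [integral_sub hFi (integrable_const _)] at hJ
  simp at hJ
  linarith

lemma Rcond_le_condRDFunction (hN : 0 < N) (D : ℝ≥0) :
    S.Rcond D ≤ condRDFunction S.jointLaw D := by
  have hN' : (0 : ℝ) < N := by exact_mod_cast hN
  have h2 : 0 < Real.log 2 := Real.log_pos one_lt_two
  refine le_iInf₂ fun R ⟨f, g, hf, hlim⟩ => S.Rcond_le_of_forall hN fun θ hθ => ?_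
  have hθ' : (0 : ℝ) < θ := hθ
  rw [← ENNReal.ofReal_coe_nnreal]
  apply ENNReal.ofReal_le_ofReal
  rw [div_le_iff₀ (by positivity)]
  refine le_of_forall_pos_le_add fun ε hε => ?_
  -- Extra distortion δ lowers the dual bound by Nδ/θ = ε. A single blocklength with distortion
  -- below D + δ then suffices.
  obtain ⟨δ, hδ⟩ : ∃ δ : ℝ≥0, (δ : ℝ) = ε * θ / N :=
    ⟨(ε * θ / N).toNNReal, Real.coe_toNNReal _ (by positivity)⟩
  have hδ' : 0 < δ := by
    rw [← NNReal.coe_pos, hδ]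
    positivity
  have hlt : limsup (fun n => ∫⁻ z, blockError (fun t => (z t).2) (g n (f n z) fun t => (z t).1)
      ∂(Measure.pi fun _ : Fin n => S.jointLaw)) atTop < ((D + δ : ℝ≥0) : ℝ≥0∞) :=
    hlim.trans_lt (by exact_mod_cast lt_add_of_pos_right D hδ')
  obtain ⟨n, hn, hn1⟩ := ((eventually_lt_of_limsup_lt hlt).and (eventually_ge_atTop 1)).exists
  have hn' : (0 : ℝ) < n := by exact_mod_cast hn1
  have h3 := (S.le_log_of_code hN hθ hn1 (numMessages_pos N n R) (hf n) (g n) hn.le).trans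
    (log_numMessages_le N n R)
  rw [show (n : ℝ) * N * R * Real.log 2 = n * (R * (N * Real.log 2)) by ring] at h3
  have h4 := le_of_mul_le_mul_left h3 hn'
  have h5 : (N : ℝ) * ((D + δ : ℝ≥0) : ℝ) / θ = N * D / θ + ε := by
    rw [NNReal.coe_add, hδ]
    field_simp
  linarith

lemma pi_law_eq_map (n : ℕ) : Measure.pi (fun _ : Fin n => S.law) =
    (Measure.pi fun _ : Fin n => S.jointLaw).map fun z t => (z t).2 := by
  have hs : ∀ _ : Fin n, SigmaFinite (S.jointLaw.map Prod.snd) := fun _ => by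
    rw [S.map_snd_jointLaw]; infer_instance
  have := Measure.pi_map_pi (μ := fun _ : Fin n => S.jointLaw) (f := fun _ => Prod.snd)
    fun _ => measurable_snd.aemeasurable
  rw [this, S.map_snd_jointLaw]

/-- Revealing the state does not increase the required rate. -/
lemma condRDFunction_le_rdFunction (D : ℝ≥0) :
    condRDFunction S.jointLaw D ≤ rdFunction S.law D := by
  refine le_iInf fun R => le_iInf fun hR => ?_
  obtain ⟨f, g, hf, hlim⟩ := hR
  have key : ∀ n, ∫⁻ z, blockError (fun t => (z t).2) (g n (f n fun t => (z t).2))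
      ∂(Measure.pi fun _ : Fin n => S.jointLaw) =
      ∫⁻ x, blockError x (g n (f n x)) ∂(Measure.pi fun _ : Fin n => S.law) := fun n => by
    have hm : Measurable fun x : Fin n → Vec N => blockError x (g n (f n x)) :=
      measurable_blockError measurable_id ((measurable_of_countable (g n)).comp (hf n))
    rw [S.pi_law_eq_map n, lintegral_map hm (by fun_prop)]
  refine iInf_le_of_le R (iInf_le _ ?_)
  refine ⟨fun n z => f n fun t => (z t).2, fun n j _ => g n j, fun n => (hf n).comp (by fun_prop),
    ?_⟩
  simp only [key]
  exact hlim

end GaussianMixture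

/-! ### Random coding -/

section RandomCoding

variable {Z Y : Type*} [MeasurableSpace Z] [MeasurableSpace Y]

lemma exists_measurable_argmin {m : ℕ} {d : Fin (m + 1) → Z → ℝ≥0∞} (hd : ∀ j, Measurable (d j)) :
    ∃ e : Z → Fin (m + 1), Measurable e ∧ ∀ z j, d (e z) z ≤ d j z := by
  induction m with
  | zero => exact ⟨fun _ => 0, measurable_const, fun z j => by rw [Fin.fin_one_eq_zero j]⟩
  | succ m ih =>
    obtain ⟨e, he, hmin⟩ := ih (d := fun j => d j.castSucc) fun j => hd _
    have hde : Measurable fun z => d (e z).castSucc z := by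
      have h1 : Measurable fun p : Fin (m + 1) × Z => d p.1.castSucc p.2 :=
        measurable_from_prod_countable_right fun j => hd j.castSucc
      exact h1.comp (he.prodMk measurable_id)
    refine ⟨fun z => if d (e z).castSucc z ≤ d (Fin.last _) z then (e z).castSucc else Fin.last _,
      Measurable.ite (measurableSet_le hde (hd _))
        ((measurable_of_countable Fin.castSucc).comp he) measurable_const, fun z j => ?_⟩
    by_cases h : d (e z).castSucc z ≤ d (Fin.last _) z
    · simp only [h, if_true]
      induction j using Fin.lastCases with
      | last => exact h
      | cast j => exact hmin z j
    · simp only [h, if_false]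
      induction j using Fin.lastCases with
      | last => exact le_rfl
      | cast j => exact (not_le.1 h).le.trans (hmin z j)

/-- Covering estimate: p is the chance that one random codeword is good, u the same under the
coupling, L a bound on the density. After (1 − p)^m ≤ exp(−um/L), convexity of exp between 0 and
−m/L finishes. -/
lemma one_sub_pow_le {p u L : ℝ} (m : ℕ) (hp1 : p ≤ 1) (hu0 : 0 ≤ u) (hu1 : u ≤ 1)
    (hL : 0 < L) (hup : u ≤ L * p) :
    (1 - p) ^ m ≤ (1 - u) + Real.exp (-(m / L)) := by
  have h1 : (1 - p) ^ m ≤ Real.exp (-(m * p)) := by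
    calc (1 - p) ^ m ≤ Real.exp (-p) ^ m :=
          pow_le_pow_left₀ (by linarith) (Real.one_sub_le_exp_neg p) m
      _ = Real.exp (-(m * p)) := by rw [← Real.exp_nat_mul]; ring_nf
  have h2 : Real.exp (-(m * p)) ≤ Real.exp (u * -(m / L)) := by
    apply Real.exp_le_exp.2
    have : u / L ≤ p := by rw [div_le_iff₀ hL]; linarith
    have h3 : (m : ℝ) * (u / L) ≤ m * p := by gcongr
    have h4 : u * -(m / L) = -(m * (u / L)) := by ring
    linarith
  have h3 := convexOn_exp.2 (Set.mem_univ 0) (Set.mem_univ (-(m / L) : ℝ))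
    (sub_nonneg.2 hu1) hu0 (by ring)
  simp only [smul_eq_mul, mul_zero, zero_add, Real.exp_zero, mul_one] at h3
  have h5 : u * Real.exp (-(m / L)) ≤ 1 * Real.exp (-(m / L)) := by gcongr
  linarith

lemma ae_lintegral_density_eq_one {μ : Measure Z} {ν : Measure Y} [IsProbabilityMeasure μ]
    [IsProbabilityMeasure ν] {f : Z × Y → ℝ≥0∞} (hf : Measurable f)
    (hfst : ((μ.prod ν).withDensity f).fst = μ) : ∀ᵐ z ∂μ, ∫⁻ y, f (z, y) ∂ν = 1 := by
  have hm : Measurable fun z => ∫⁻ y, f (z, y) ∂ν := hf.lintegral_prod_right'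
  have h1 : μ.withDensity (fun z => ∫⁻ y, f (z, y) ∂ν) = μ.withDensity 1 := by
    rw [withDensity_one]
    refine Measure.ext_of_lintegral _ fun φ hφ => ?_
    conv_rhs => rw [← hfst, Measure.fst, lintegral_map hφ measurable_fst,
      lintegral_withDensity_eq_lintegral_mul _ hf (by fun_prop), lintegral_prod _ (by fun_prop)]
    rw [lintegral_withDensity_eq_lintegral_mul _ hm hφ]
    refine lintegral_congr fun z => ?_
    simp only [Pi.mul_apply]
    rw [lintegral_mul_const _ (by fun_prop)]
  refine (withDensity_eq_iff hm.aemeasurable (by fun_prop) ?_).1 h1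
  have h2 := congrArg (fun m : Measure Z => m Set.univ) h1
  simp only [withDensity_one, measure_univ, withDensity_apply _ MeasurableSet.univ,
    Measure.restrict_univ] at h2
  rw [h2]
  exact ENNReal.one_ne_top

/-- A random codebook drawn from `ν` misses the good set `G` rarely. -/
lemma exists_codebook {μ : Measure Z} {ν : Measure Y} [IsProbabilityMeasure μ]
    [IsProbabilityMeasure ν] {f : Z × Y → ℝ≥0∞} (hf : Measurable f)
    (hfst : ((μ.prod ν).withDensity f).fst = μ) {G : Set (Z × Y)} (hG : MeasurableSet G)
    {L : ℝ} (hL : 0 < L) (hfG : ∀ p ∈ G, f p ≤ ENNReal.ofReal L) {d₀ : Z → ℝ≥0∞}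
    (hd₀ : Measurable d₀) (m : ℕ) :
    ∃ c : Fin m → Y, ∫⁻ z, d₀ z * ∏ j, Gᶜ.indicator 1 (z, c j) ∂μ ≤
      ∫⁻ p in Gᶜ, d₀ p.1 ∂((μ.prod ν).withDensity f) +
        ENNReal.ofReal (Real.exp (-(m / L))) * ∫⁻ z, d₀ z ∂μ := by
  have hGm : Measurable (Gᶜ.indicator (1 : Z × Y → ℝ≥0∞)) := measurable_one.indicator hG.compl
  have hjoint : Measurable fun p : (Fin m → Y) × Z => d₀ p.2 * ∏ j, Gᶜ.indicator 1 (p.2, p.1 j) :=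
    (hd₀.comp measurable_snd).mul
      (Finset.measurable_prod _ fun j _ => hGm.comp (by fun_prop))
  -- Some codebook does no worse than the average; under the average the m independent misses at z
  -- become an m-th power.
  obtain ⟨c, hc⟩ := exists_le_lintegral (μ := Measure.pi fun _ : Fin m => ν)
    (f := fun c => ∫⁻ z, d₀ z * ∏ j, Gᶜ.indicator 1 (z, c j) ∂μ)
    hjoint.lintegral_prod_right'.aemeasurable
  refine ⟨c, hc.trans ?_⟩
  rw [lintegral_lintegral_swap hjoint.aemeasurable]
  have hb : Measurable fun p : Z × Y => Gᶜ.indicator 1 p * f p := hGm.mul hf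
  have h1 : ∫⁻ p in Gᶜ, d₀ p.1 ∂((μ.prod ν).withDensity f) =
      ∫⁻ z, d₀ z * ∫⁻ y, Gᶜ.indicator 1 (z, y) * f (z, y) ∂ν ∂μ := by
    rw [← lintegral_indicator hG.compl, lintegral_withDensity_eq_lintegral_mul _ hf
      (Measurable.indicator (by fun_prop) hG.compl), lintegral_prod _
      (hf.mul (Measurable.indicator (by fun_prop) hG.compl)).aemeasurable]
    refine lintegral_congr fun z => ?_
    rw [← lintegral_const_mul _ (by fun_prop)]
    refine lintegral_congr fun y => ?_
    by_cases hy : (z, y) ∈ G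
    · simp [hy]
    · simp [hy, mul_comm]
  have hb'' : Measurable fun z => d₀ z * ∫⁻ y, Gᶜ.indicator 1 (z, y) * f (z, y) ∂ν :=
    hd₀.mul hb.lintegral_prod_right'
  rw [h1, ← lintegral_const_mul _ hd₀, ← lintegral_add_left hb'']
  refine lintegral_mono_ae ?_
  filter_upwards [ae_lintegral_density_eq_one hf hfst] with z hz
  have hGz : Measurable fun y => Gᶜ.indicator (1 : Z × Y → ℝ≥0∞) (z, y) :=
    hGm.comp measurable_prodMk_left
  have hprod : Measurable fun c : Fin m → Y => ∏ j, Gᶜ.indicator (1 : Z × Y → ℝ≥0∞) (z, c j) :=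
    Finset.measurable_prod _ fun j _ => hGz.comp (measurable_pi_apply j)
  rw [lintegral_const_mul _ hprod, mul_comm (ENNReal.ofReal _), ← mul_add]
  gcongr
  rw [lintegral_pi_prod (fun _ : Fin m => ν)
    (f := fun _ y => Gᶜ.indicator (1 : Z × Y → ℝ≥0∞) (z, y)) fun _ => hGz]
  simp only [Finset.prod_const, Finset.card_univ, Fintype.card_fin]
  set s : Set Y := Prod.mk z ⁻¹' G with hs
  have hsm : MeasurableSet s := measurable_prodMk_left hG
  have hind : ∀ y, Gᶜ.indicator (1 : Z × Y → ℝ≥0∞) (z, y) = sᶜ.indicator 1 y := fun y => rfl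
  simp only [hind]
  rw [lintegral_indicator_one hsm.compl]
  have hfz : Measurable fun y => f (z, y) := by fun_prop
  have hb' : ∫⁻ y, sᶜ.indicator 1 y * f (z, y) ∂ν = ∫⁻ y in sᶜ, f (z, y) ∂ν := by
    rw [← lintegral_indicator hsm.compl]
    refine lintegral_congr fun y => ?_
    by_cases hy : y ∈ s <;> simp [hy]
  rw [hb']
  have hsplit : ∫⁻ y in s, f (z, y) ∂ν + ∫⁻ y in sᶜ, f (z, y) ∂ν = 1 := by
    rw [lintegral_add_compl _ hsm, hz]
  have hu_top : ∫⁻ y in s, f (z, y) ∂ν ≠ ∞ :=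
    ne_top_of_le_ne_top ENNReal.one_ne_top (hsplit ▸ le_self_add)
  have hb_top : ∫⁻ y in sᶜ, f (z, y) ∂ν ≠ ∞ :=
    ne_top_of_le_ne_top ENNReal.one_ne_top (hsplit ▸ le_add_self)
  have hreal : (∫⁻ y in s, f (z, y) ∂ν).toReal + (∫⁻ y in sᶜ, f (z, y) ∂ν).toReal = 1 := by
    rw [← ENNReal.toReal_add hu_top hb_top, hsplit, ENNReal.toReal_one]
  have hup : (∫⁻ y in s, f (z, y) ∂ν).toReal ≤ L * ν.real s := by
    have h2 : ∫⁻ y in s, f (z, y) ∂ν ≤ ENNReal.ofReal L * ν s := by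
      calc _ ≤ ∫⁻ _ in s, ENNReal.ofReal L ∂ν := setLIntegral_mono' hsm fun y hy => hfG _ hy
        _ = _ := by simp
    have h3 := ENNReal.toReal_mono (by finiteness) h2
    rwa [ENNReal.toReal_mul, ENNReal.toReal_ofReal hL.le] at h3
  have key := one_sub_pow_le m (measureReal_le_one (μ := ν) (s := s)) ENNReal.toReal_nonneg
    (by linarith [ENNReal.toReal_nonneg (a := ∫⁻ y in sᶜ, f (z, y) ∂ν)]) hL hup
  have hcompl : ν sᶜ = ENNReal.ofReal (1 - ν.real s) := by
    rw [← probReal_compl_eq_one_sub hsm, ofReal_measureReal]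
  rw [hcompl, ← ENNReal.ofReal_pow (sub_nonneg.2 measureReal_le_one)]
  refine (ENNReal.ofReal_le_ofReal key).trans ?_
  refine ENNReal.ofReal_add_le.trans ?_
  gcongr
  rw [← hreal, add_sub_cancel_left, ENNReal.ofReal_toReal hb_top]

/-- Single-shot achievability: a code with `m` random codewords and one reference word `y₀`. -/
lemma exists_code_of_coupling {μ : Measure Z} {ν : Measure Y} [IsProbabilityMeasure μ]
    [IsProbabilityMeasure ν] {F : Z × Y → ℝ} (hF : Measurable F)
    (hfst : ((μ.prod ν).withDensity fun p => ENNReal.ofReal (Real.exp (F p))).fst = μ)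
    {d : Z × Y → ℝ≥0∞} (hd : Measurable d) (δ : ℝ≥0∞) (ℓ : ℝ) (y₀ : Y) (m : ℕ) :
    ∃ (e : Z → Fin (m + 1)) (g : Fin (m + 1) → Y), Measurable e ∧
      ∫⁻ z, d (z, g (e z)) ∂μ ≤ δ +
        (∫⁻ p in {p | δ < d p ∨ ℓ < F p}, d (p.1, y₀)
          ∂((μ.prod ν).withDensity fun p => ENNReal.ofReal (Real.exp (F p))) +
        ENNReal.ofReal (Real.exp (-(m / Real.exp ℓ))) * ∫⁻ z, d (z, y₀) ∂μ) := by
  set G : Set (Z × Y) := {p | d p ≤ δ ∧ F p ≤ ℓ} with hGdef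
  have hG : MeasurableSet G :=
    (measurableSet_le hd measurable_const).inter (measurableSet_le hF measurable_const)
  have hGc : {p | δ < d p ∨ ℓ < F p} = Gᶜ := by
    ext p
    simp [hGdef, not_le, imp_iff_not_or]
  have hd₀ : Measurable fun z => d (z, y₀) := by fun_prop
  obtain ⟨c, hc⟩ := exists_codebook (f := fun p => ENNReal.ofReal (Real.exp (F p)))
    (by fun_prop) hfst hG (Real.exp_pos ℓ)
    (fun p hp => ENNReal.ofReal_le_ofReal (Real.exp_le_exp.2 hp.2)) hd₀ m
  -- The minimum-distortion encoder pays at most δ if some random codeword is good, and otherwise at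
  -- most the cost of the nonrandom word y₀.
  set g : Fin (m + 1) → Y := Fin.cons y₀ c with hg
  obtain ⟨e, he, hmin⟩ := exists_measurable_argmin (d := fun j z => d (z, g j)) fun j => by fun_prop
  refine ⟨e, g, he, ?_⟩
  rw [hGc]
  refine le_trans ?_ (add_le_add_right hc δ)
  calc ∫⁻ z, d (z, g (e z)) ∂μ
      ≤ ∫⁻ z, (δ + d (z, y₀) * ∏ j, Gᶜ.indicator 1 (z, c j)) ∂μ := by
        refine lintegral_mono fun z => ?_
        by_cases hz : ∃ j, (z, c j) ∈ G
        · obtain ⟨j, hj⟩ := hz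
          have h1 := hmin z j.succ
          simp only [hg, Fin.cons_succ] at h1
          exact (h1.trans hj.1).trans le_self_add
        · push Not at hz
          have h1 := hmin z 0
          simp only [hg, Fin.cons_zero] at h1
          refine h1.trans (le_trans (le_of_eq ?_) le_add_self)
          simp [hz]
    _ = δ + ∫⁻ z, d (z, y₀) * ∏ j, Gᶜ.indicator 1 (z, c j) ∂μ := by
        rw [lintegral_add_left measurable_const]
        simp

end RandomCoding

/-! ### Achievability for memoryless sources -/

section Achievability

variable {Z Y : Type*} [MeasurableSpace Z] [MeasurableSpace Y]

lemma pi_sum_tail_le {Ω : Type*} [MeasurableSpace Ω] {P : Measure Ω} [IsProbabilityMeasure P]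
    {X : Ω → ℝ} (hX : MemLp X 2 P) {n : ℕ} (hn : 0 < n) {δ : ℝ} (hδ : 0 < δ) :
    (Measure.pi fun _ : Fin n => P) {z | n * (∫ ω, X ω ∂P + δ) < ∑ t, X (z t)} ≤
      ENNReal.ofReal (Var[X; P] / (n * δ ^ 2)) := by
  have hn' : (0 : ℝ) < n := by exact_mod_cast hn
  have hXt : ∀ t : Fin n, MemLp (fun z : Fin n → Ω => X (z t)) 2 (Measure.pi fun _ => P) := fun t =>
    hX.comp_measurePreserving (measurePreserving_eval (fun _ : Fin n => P) t)
  have hS : MemLp (∑ t, fun z : Fin n → Ω => X (z t)) 2 (Measure.pi fun _ => P) :=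
    memLp_finsetSum' _ fun t _ => hXt t
  have hmean : ∫ z, (∑ t, fun z : Fin n → Ω => X (z t)) z ∂(Measure.pi fun _ => P) =
      n * ∫ ω, X ω ∂P := by
    simp only [Finset.sum_apply]
    rw [integral_finsetSum _ fun t _ => (hXt t).integrable one_le_two]
    simp only [integral_comp_eval (μ := fun _ : Fin n => P) hX.aestronglyMeasurable]
    simp
  have hvar := variance_sum_pi (μ := fun _ : Fin n => P) (X := fun _ => X) fun _ => hX
  have h1 := meas_ge_le_variance_div_sq hS (c := n * δ) (by positivity)
  rw [hvar, hmean] at h1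
  refine (measure_mono fun z hz => ?_).trans (h1.trans (le_of_eq ?_))
  · simp only [Set.mem_ofPred_eq, Finset.sum_apply] at hz ⊢
    refine le_trans ?_ (le_abs_self _)
    linarith
  · congr 1
    simp only [Finset.sum_const, Finset.card_univ, Fintype.card_fin, nsmul_eq_mul]
    field_simp

variable {μ : Measure Z} {ν : Measure Y} {A : Z → ℝ} {q : Z × Y → ℝ} {Λ Δ : ℝ}

/-- Block codes for a matched pair, with an explicit bound on the expected cost. -/
lemma MatchedPair.exists_block_code (h : MatchedPair μ ν A q Λ Δ) (hq0 : ∀ p, 0 ≤ q p) {y₀ : Y}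
    (hy₀ : MemLp (fun z => q (z, y₀)) 2 μ) {n : ℕ} (hn : 0 < n) {δ η : ℝ} (hδ : 0 < δ)
    (hη : 0 < η) (m : ℕ) :
    ∃ (e : (Fin n → Z) → Fin (m + 1)) (g : Fin (m + 1) → Fin n → Y), Measurable e ∧
      ∫⁻ z, ENNReal.ofReal ((∑ t, q (z t, g (e z) t)) / n) ∂(Measure.pi fun _ : Fin n => μ) ≤
        ENNReal.ofReal ((Δ + δ) + ((η * ∫ z, q (z, y₀) ^ 2 ∂μ + 1 / (4 * η) *
          ((Var[q; coupling μ ν A q] + Var[fun p => A p.1 - q p; coupling μ ν A q]) /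
            (n * δ ^ 2))) +
          Real.exp (-(m / Real.exp (n * (Λ - Δ + δ)))) * ∫ z, q (z, y₀) ∂μ)) := by
  have hn' : (0 : ℝ) < n := by exact_mod_cast hn
  have := h.prob_left
  have := h.prob_right
  have := h.isProbabilityMeasure_coupling
  have hA := h.measurable_potential
  have hq := h.measurable_cost
  have hpi := MatchedPair.pi fun _ : Fin n => h
  have hc := coupling_pi fun _ : Fin n => h
  set ρ := coupling μ ν A q with hρ
  have hAρ : MemLp (fun p : Z × Y => A p.1) 2 ρ := by
    have h1 := h.memLp_potential
    rw [← h.fst_coupling] at h1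
    exact (memLp_map_measure_iff (by
      exact hA.aestronglyMeasurable) measurable_fst.aemeasurable).1 h1
  have hFρ : MemLp (fun p : Z × Y => A p.1 - q p) 2 ρ := hAρ.sub h.memLp_cost
  have hFint : ∫ p, (A p.1 - q p) ∂ρ = Λ - Δ := by
    rw [integral_sub (hAρ.integrable one_le_two) (h.memLp_cost.integrable one_le_two),
      h.integral_cost]
    congr 1
    rw [← h.integral_potential]
    conv_rhs => rw [← h.fst_coupling]
    exact (integral_map measurable_fst.aemeasurable hA.aestronglyMeasurable).symm
  set q₀ : Z → ℝ := fun z => q (z, y₀) with hq₀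
  have hq₀m : Measurable q₀ := by fun_prop
  have hΔ : 0 ≤ Δ := by
    rw [← h.integral_cost]
    exact integral_nonneg hq0
  have hqn : Measurable fun p : (Fin n → Z) × (Fin n → Y) => ∑ t, q (p.1 t, p.2 t) :=
    hpi.measurable_cost
  have hAn := hpi.measurable_potential
  have hQ0 : 0 ≤ ∫ z, q₀ z ^ 2 ∂μ := integral_nonneg fun z => by positivity
  have hV0 : 0 ≤ Var[q; ρ] := variance_nonneg _ _
  have hV0' : 0 ≤ Var[fun p => A p.1 - q p; ρ] := variance_nonneg _ _
  have hq₀0 : 0 ≤ ∫ z, q₀ z ∂μ := integral_nonneg fun z => hq0 _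
  obtain ⟨e, g, he, hle⟩ := exists_code_of_coupling (μ := Measure.pi fun _ : Fin n => μ)
    (ν := Measure.pi fun _ : Fin n => ν)
    (F := fun p => ∑ t, A (p.1 t) - ∑ t, q (p.1 t, p.2 t)) (by fun_prop) hpi.fst_coupling
    (d := fun p => ENNReal.ofReal ((∑ t, q (p.1 t, p.2 t)) / n)) (by fun_prop)
    (ENNReal.ofReal (Δ + δ)) (n * (Λ - Δ + δ)) (fun _ => y₀) m
  refine ⟨e, g, he, hle.trans ?_⟩
  set ρn := (Measure.pi fun _ : Fin n => μ).prod (Measure.pi fun _ : Fin n => ν) |>.withDensity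
    fun p => ENNReal.ofReal (Real.exp (∑ t, A (p.1 t) - ∑ t, q (p.1 t, p.2 t))) with hρn
  have hρn' : ρn = (Measure.pi fun _ : Fin n => ρ).map
      (fun z => (fun i => (z i).1, fun i => (z i).2)) := hc
  have hs : Measurable (fun z : Fin n → Z × Y => ((fun i => (z i).1, fun i => (z i).2) :
    (Fin n → Z) × (Fin n → Y))) := by fun_prop
  have hfst : ρn.map Prod.fst = Measure.pi fun _ : Fin n => μ := hpi.fst_coupling
  -- the exceptional set has small probability
  have hbad : ρn {p | ENNReal.ofReal (Δ + δ) < ENNReal.ofReal ((∑ t, q (p.1 t, p.2 t)) / n) ∨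
      n * (Λ - Δ + δ) < ∑ t, A (p.1 t) - ∑ t, q (p.1 t, p.2 t)} ≤
      ENNReal.ofReal ((Var[q; ρ] + Var[fun p => A p.1 - q p; ρ]) / (n * δ ^ 2)) := by
    rw [hρn', Measure.map_apply hs]
    · have h1 := pi_sum_tail_le h.memLp_cost hn hδ
      have h2 := pi_sum_tail_le hFρ hn hδ
      rw [h.integral_cost] at h1
      rw [hFint] at h2
      rw [add_div]
      refine le_trans ?_ (ENNReal.ofReal_add (div_nonneg hV0 (by positivity))
        (div_nonneg hV0' (by positivity))).ge
      refine le_trans (measure_mono ?_) ((measure_union_le _ _).trans (add_le_add h1 h2))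
      rintro z (hz | hz)
      · left
        have h3 := (ENNReal.ofReal_lt_ofReal_iff_of_nonneg (by positivity)).1 hz
        rw [lt_div_iff₀ hn', mul_comm] at h3
        exact h3
      · right
        simpa [Finset.sum_sub_distrib] using hz
    · have h1 : MeasurableSet {p : (Fin n → Z) × (Fin n → Y) |
          ENNReal.ofReal (Δ + δ) < ENNReal.ofReal ((∑ t, q (p.1 t, p.2 t)) / n)} :=
        measurableSet_lt (by fun_prop) (by fun_prop)
      have h2 : MeasurableSet {p : (Fin n → Z) × (Fin n → Y) |
          n * (Λ - Δ + δ) < ∑ t, A (p.1 t) - ∑ t, q (p.1 t, p.2 t)} :=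
        measurableSet_lt (by fun_prop) (by fun_prop)
      exact h1.union h2
  -- cost of the reference word
  have hmean : ∫⁻ z, ENNReal.ofReal ((∑ t, q₀ (z t)) / n) ∂(Measure.pi fun _ : Fin n => μ) ≤
      ENNReal.ofReal (∫ z, q₀ z ∂μ) := by
    have hi : ∀ t : Fin n, Integrable (fun z : Fin n → Z => q₀ (z t)) (Measure.pi fun _ => μ) :=
      fun t => integrable_comp_eval (μ := fun _ : Fin n => μ) (hy₀.integrable one_le_two)
    rw [← ofReal_integral_eq_lintegral_ofReal ((integrable_finsetSum _ fun t _ => hi t).div_const _)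
      (Eventually.of_forall fun z => div_nonneg (Finset.sum_nonneg fun t _ => hq0 _) hn'.le),
      integral_div, integral_finsetSum _ fun t _ => hi t]
    simp only [integral_comp_eval (μ := fun _ : Fin n => μ) hq₀m.aestronglyMeasurable]
    simp [hn'.ne']
  have hsq : ∫⁻ z, ENNReal.ofReal (η * ((∑ t, q₀ (z t)) / n) ^ 2)
      ∂(Measure.pi fun _ : Fin n => μ) ≤ ENNReal.ofReal (η * ∫ z, q₀ z ^ 2 ∂μ) := by
    have hi : ∀ t : Fin n, Integrable (fun z : Fin n → Z => q₀ (z t) ^ 2)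
        (Measure.pi fun _ => μ) :=
      fun t => integrable_comp_eval (μ := fun _ : Fin n => μ) (f := fun z => q₀ z ^ 2)
        hy₀.integrable_sq
    calc _ ≤ ∫⁻ z, ENNReal.ofReal (η * ((∑ t, q₀ (z t) ^ 2) / n))
          ∂(Measure.pi fun _ : Fin n => μ) := by
          refine lintegral_mono fun z => ENNReal.ofReal_le_ofReal ?_
          gcongr
          have h1 := sq_sum_le_card_mul_sum_sq (s := Finset.univ) (f := fun t => q₀ (z t))
          simp only [Finset.card_univ, Fintype.card_fin] at h1
          rw [div_pow, div_le_div_iff₀ (by positivity) hn']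
          nlinarith
      _ = _ := by
          rw [← ofReal_integral_eq_lintegral_ofReal
            (((integrable_finsetSum _ fun t _ => hi t).div_const _).const_mul _)
            (Eventually.of_forall fun z => by positivity), integral_const_mul, integral_div,
            integral_finsetSum _ fun t _ => hi t]
          simp only [integral_comp_eval (μ := fun _ : Fin n => μ) (f := fun z => q₀ z ^ 2)
            (by fun_prop : Measurable fun z => q₀ z ^ 2).aestronglyMeasurable]
          simp [hn'.ne']
  have hexc : ∫⁻ p in {p | ENNReal.ofReal (Δ + δ) <
        ENNReal.ofReal ((∑ t, q (p.1 t, p.2 t)) / n) ∨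
      n * (Λ - Δ + δ) < ∑ t, A (p.1 t) - ∑ t, q (p.1 t, p.2 t)},
      ENNReal.ofReal ((∑ t, q₀ (p.1 t)) / n) ∂ρn ≤
      ENNReal.ofReal (η * ∫ z, q₀ z ^ 2 ∂μ + 1 / (4 * η) *
          ((Var[q; ρ] + Var[fun p => A p.1 - q p; ρ]) / (n * δ ^ 2))) := by
    calc _ ≤ ∫⁻ p in {p | ENNReal.ofReal (Δ + δ) <
            ENNReal.ofReal ((∑ t, q (p.1 t, p.2 t)) / n) ∨
          n * (Λ - Δ + δ) < ∑ t, A (p.1 t) - ∑ t, q (p.1 t, p.2 t)},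
          (ENNReal.ofReal (η * ((∑ t, q₀ (p.1 t)) / n) ^ 2) +
            ENNReal.ofReal (1 / (4 * η))) ∂ρn := by
          refine lintegral_mono fun p => ?_
          rw [← ENNReal.ofReal_add (by positivity) (by positivity)]
          apply ENNReal.ofReal_le_ofReal
          -- Completing the square gives a ≤ ηa² + 1/(4η): the unbounded reference cost becomes a
          -- small multiple of its second moment plus a constant, which is then weighted by the
          -- probability of the exceptional set.
          generalize (∑ t, q₀ (p.1 t)) / n = a
          have h1 : 0 ≤ (2 * η * a - 1) ^ 2 / (4 * η) := by positivity
          have h2 : (2 * η * a - 1) ^ 2 / (4 * η) = η * a ^ 2 + 1 / (4 * η) - a := by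
            field_simp
            ring
          linarith
      _ ≤ ENNReal.ofReal (η * ∫ z, q₀ z ^ 2 ∂μ) + ENNReal.ofReal (1 / (4 * η)) *
          ENNReal.ofReal ((Var[q; ρ] + Var[fun p => A p.1 - q p; ρ]) / (n * δ ^ 2)) := by
          rw [lintegral_add_right _ measurable_const, setLIntegral_const]
          gcongr
          refine (setLIntegral_le_lintegral _ _).trans (le_trans (le_of_eq ?_) hsq)
          rw [← hfst, lintegral_map (by fun_prop) measurable_fst]
      _ = _ := by
          rw [← ENNReal.ofReal_mul (by positivity), ← ENNReal.ofReal_add (by positivity)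
            (by positivity)]
  rw [ENNReal.ofReal_add (p := Δ + δ) (by positivity) (by positivity),
    ENNReal.ofReal_add (p := η * _ + _) (by positivity) (by positivity),
    ENNReal.ofReal_mul (Real.exp_pos _).le]
  gcongr

/-- Every rate above `Λ - Δ` nats achieves the cost `Δ` asymptotically. -/
lemma MatchedPair.eventually_exists_code (h : MatchedPair μ ν A q Λ Δ) (hq0 : ∀ p, 0 ≤ q p)
    (hI : 0 ≤ Λ - Δ) {r : ℝ} (hr : Λ - Δ < r) {M : ℕ → ℕ} (hM0 : ∀ n, 0 < M n)
    (hM : ∀ n : ℕ, Real.exp (n * r) ≤ M n + 1) {ε : ℝ} (hε : 0 < ε) :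
    ∀ᶠ n : ℕ in atTop, ∃ (e : (Fin n → Z) → Fin (M n)) (g : Fin (M n) → Fin n → Y),
      Measurable e ∧
      ∫⁻ z, ENNReal.ofReal ((∑ t, q (z t, g (e z) t)) / n) ∂(Measure.pi fun _ : Fin n => μ) ≤
        ENNReal.ofReal (Δ + ε) := by
  obtain ⟨y₀, hy₀⟩ := h.exists_ref
  set Q := ∫ z, q (z, y₀) ^ 2 ∂μ with hQ
  have hQ0 : 0 ≤ Q := integral_nonneg fun z => by positivity
  set q₁ := ∫ z, q (z, y₀) ∂μ with hq₁
  have hq₁0 : 0 ≤ q₁ := integral_nonneg fun z => hq0 _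
  set V := Var[q; coupling μ ν A q] + Var[fun p => A p.1 - q p; coupling μ ν A q] with hV
  -- Of the rate margin, one δ raises the threshold on the log-density and another is left as the
  -- exponent by which the codewords outnumber exp(n(Λ − Δ + δ)).
  set δ := min (ε / 4) ((r - (Λ - Δ)) / 2) with hδdef
  have hδ : 0 < δ := lt_min (by positivity) (by linarith)
  have hδε : δ ≤ ε / 4 := min_le_left _ _
  have hδr : Λ - Δ + δ + δ ≤ r := by
    have : δ ≤ (r - (Λ - Δ)) / 2 := min_le_right _ _
    linarith
  -- Makes ηQ ≤ ε/4; the added 1 covers Q = 0.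
  set η := ε / (4 * (Q + 1)) with hηdef
  have hη : 0 < η := by positivity
  have hηQ : η * Q ≤ ε / 4 := by
    rw [hηdef, div_mul_eq_mul_div, div_le_div_iff₀ (by positivity) (by positivity)]
    nlinarith
  have hT1 : Tendsto (fun n : ℕ => 1 / (4 * η) * (V / (n * δ ^ 2))) atTop (nhds 0) := by
    have h1 : Tendsto (fun n : ℕ => (n : ℝ) * δ ^ 2) atTop atTop :=
      tendsto_natCast_atTop_atTop.atTop_mul_const (by positivity)
    simpa using (h1.const_div_atTop V).const_mul (1 / (4 * η))
  -- The constant 2 collects the rounding in `hM` and the message spent on the reference word: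
  -- exp(nr) ≤ M n + 1 = m + 2.
  have hT2 : Tendsto (fun n : ℕ => Real.exp (2 - Real.exp (n * δ)) * q₁) atTop (nhds 0) := by
    have h1 : Tendsto (fun n : ℕ => Real.exp ((n : ℝ) * δ)) atTop atTop :=
      Real.tendsto_exp_atTop.comp (tendsto_natCast_atTop_atTop.atTop_mul_const hδ)
    have h2 : Tendsto (fun n : ℕ => 2 - Real.exp ((n : ℝ) * δ)) atTop atBot :=
      tendsto_atBot_add_const_left _ 2 (tendsto_neg_atTop_atBot.comp h1)
    simpa using (Real.tendsto_exp_atBot.comp h2).mul_const q₁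
  have hT := (hT1.add hT2).eventually (gt_mem_nhds (show (0 : ℝ) + 0 < ε / 4 by linarith))
  filter_upwards [hT, eventually_ge_atTop 1] with n hn hn1
  obtain ⟨m, hm⟩ : ∃ m, M n = m + 1 := ⟨M n - 1, by have := hM0 n; omega⟩
  rw [hm]
  obtain ⟨e, g, he, hle⟩ := h.exists_block_code hq0 hy₀ hn1 hδ hη m
  refine ⟨e, g, he, hle.trans (ENNReal.ofReal_le_ofReal ?_)⟩
  have hn0 : (0 : ℝ) ≤ n := n.cast_nonneg
  have hexp : Real.exp (-(m / Real.exp (n * (Λ - Δ + δ)))) ≤ Real.exp (2 - Real.exp (n * δ)) := by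
    apply Real.exp_le_exp.2
    have h1 : Real.exp (n * δ) * Real.exp (n * (Λ - Δ + δ)) ≤ m + 2 := by
      have h2 := hM n
      rw [hm] at h2
      push_cast at h2
      rw [← Real.exp_add]
      calc Real.exp (n * δ + n * (Λ - Δ + δ)) ≤ Real.exp (n * r) := by
            apply Real.exp_le_exp.2
            nlinarith
        _ ≤ m + 2 := by linarith
    have h3 : (1 : ℝ) ≤ Real.exp (n * (Λ - Δ + δ)) := Real.one_le_exp (by positivity)
    have h4 : Real.exp (n * δ) - 2 ≤ m / Real.exp (n * (Λ - Δ + δ)) := by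
      rw [le_div_iff₀ (by positivity)]
      nlinarith
    linarith
  have h5 : Real.exp (-(m / Real.exp (n * (Λ - Δ + δ)))) * q₁ ≤
      Real.exp (2 - Real.exp (n * δ)) * q₁ := by gcongr
  linarith

end Achievability

/-! ### Coding theorem with the state at both terminals. -/

namespace GaussianMixture

variable {N K : ℕ} (S : GaussianMixture N K)

lemma sum_weight_lag_sub {θ : ℝ≥0} :
    ∑ c, (S.weight c : ℝ) * ∑ m, lag (S.eig c m) θ -
      ∑ c, (S.weight c : ℝ) * ∑ m, min (S.eig c m : ℝ) θ / θ = S.meanGain θ := by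
  unfold meanGain
  rw [← Finset.sum_sub_distrib]
  refine Finset.sum_congr rfl fun c _ => ?_
  rw [← mul_sub, ← Finset.sum_sub_distrib]
  simp [lag]

/-- Distortion per complex dimension is θ/N times the normalised cost, whence the slack Nε/θ. The
decoder evaluates each strategy letter of its codeword at the known state. -/
lemma eventually_exists_code (hN : 0 < N) {θ : ℝ≥0} (hθ : 0 < θ) {R : ℝ≥0}
    (hR : S.meanGain θ < N * R * Real.log 2) {ε : ℝ≥0} (hε : 0 < ε) :
    ∀ᶠ n : ℕ in atTop, ∃ (f : (Fin n → Fin K × Vec N) → Fin (numMessages N n R))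
      (g : Fin (numMessages N n R) → (Fin n → Fin K) → (Fin n → Vec N)), Measurable f ∧
      ∫⁻ z, blockError (fun t => (z t).2) (g (f z) fun t => (z t).1)
        ∂(Measure.pi fun _ : Fin n => S.jointLaw) ≤ S.meanDistortion θ + ε := by
  have hN' : (0 : ℝ) < N := by exact_mod_cast hN
  have hθ' : (0 : ℝ) < θ := hθ
  have hε' : (0 : ℝ) < ε := hε
  obtain ⟨ν, A, h⟩ := S.exists_matchedPair hθ
  have hmix := MatchedPair.mix S.weight_sum h
  have hsub := S.sum_weight_lag_sub (θ := θ)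
  have hev := hmix.eventually_exists_code (fun p => by positivity)
    (by rw [hsub]; exact S.meanGain_nonneg hθ) (r := N * R * Real.log 2) (by rwa [hsub])
    (M := fun n => numMessages N n R) (fun n => numMessages_pos N n R) (fun n => by
      have h1 : Real.exp (n * (N * R * Real.log 2)) = 2 ^ ((n : ℝ) * N * R) := by
        rw [Real.rpow_def_of_pos two_pos]
        ring_nf
      rw [h1]
      exact (Nat.lt_floor_add_one _).le) (ε := N * ε / θ) (by positivity)
  filter_upwards [hev, eventually_ge_atTop 1] with n hn hn1
  have hn' : (0 : ℝ) < n := by exact_mod_cast hn1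
  obtain ⟨f, g, hf, hle⟩ := hn
  refine ⟨f, fun j c t => g j t (c t), hf, ?_⟩
  have herr : ∀ z : Fin n → Fin K × Vec N,
      blockError (fun t => (z t).2) (fun t => g (f z) t (z t).1) =
        ENNReal.ofReal (θ / N) *
          ENNReal.ofReal ((∑ t, ‖(z t).2 - g (f z) t (z t).1‖ ^ 2 / θ) / n) := fun z => by
    have h1 : (∑ t, ‖(z t).2 - g (f z) t (z t).1‖ₑ ^ 2) =
        ENNReal.ofReal (∑ t, ‖(z t).2 - g (f z) t (z t).1‖ ^ 2) := by
      rw [ENNReal.ofReal_sum_of_nonneg fun t _ => by positivity]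
      refine Finset.sum_congr rfl fun t _ => ?_
      rw [ENNReal.ofReal_pow (norm_nonneg _), ofReal_norm]
    rw [blockError, h1, ← ENNReal.ofReal_natCast, ← ENNReal.ofReal_natCast,
      ← ENNReal.ofReal_mul hn'.le, ← ENNReal.ofReal_div_of_pos (by positivity),
      ← ENNReal.ofReal_mul (by positivity), ← Finset.sum_div]
    congr 1
    field_simp
  simp only [herr]
  rw [lintegral_const_mul' _ _ ENNReal.ofReal_ne_top]
  refine (mul_le_mul_right hle _).trans (le_of_eq ?_)
  rw [← ENNReal.ofReal_mul (by positivity), ← ENNReal.ofReal_coe_nnreal,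
    ← ENNReal.ofReal_coe_nnreal, ← ENNReal.ofReal_add (by positivity) (by positivity)]
  congr 1
  have h2 : ∑ c, (S.weight c : ℝ) * ∑ m, min (S.eig c m : ℝ) θ / θ =
      N * S.meanDistortion θ / θ := by
    have h3 := S.meanLag_eq hN θ
    unfold meanLag at h3
    linarith
  rw [h2]
  field_simp

lemma achievableWithState (hN : 0 < N) {θ : ℝ≥0} (hθ : 0 < θ) {R D : ℝ≥0}
    (hR : S.meanGain θ < N * R * Real.log 2) (hD : S.meanDistortion θ ≤ D) :
    AchievableWithState S.jointLaw R D := by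
  let cost : ∀ n, ((Fin n → Fin K × Vec N) → Fin (numMessages N n R)) ×
      (Fin (numMessages N n R) → (Fin n → Fin K) → (Fin n → Vec N)) → ℝ≥0∞ := fun n c =>
    ∫⁻ z, blockError (fun t => (z t).2) (c.2 (c.1 z) fun t => (z t).1)
        ∂(Measure.pi fun _ : Fin n => S.jointLaw)
  -- Good codes are known for each ε only at large n, whereas one sequence must serve all ε. A code
  -- within 1/n of the infimal distortion at each n competes with all of them; at n = 0 the slack is
  -- ∞.
  have hnear : ∀ n, ∃ c, Measurable c.1 ∧ ∀ b : ℝ≥0∞, (∃ c', Measurable c'.1 ∧ cost n c' ≤ b) →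
      cost n c ≤ b + (n : ℝ≥0∞)⁻¹ := fun n => by
    set opt : ℝ≥0∞ := ⨅ (c) (_ : Measurable c.1), cost n c with hopt
    by_cases htop : opt = ∞
    · refine ⟨⟨fun _ => ⟨0, numMessages_pos N n R⟩, fun _ _ _ => 0⟩, measurable_const, ?_⟩
      rintro b ⟨c', hc', hb⟩
      have : opt ≤ b := (iInf₂_le c' hc').trans hb
      rw [htop, top_le_iff] at this
      simp [this]
    · have hlt : opt < opt + (n : ℝ≥0∞)⁻¹ :=
        ENNReal.lt_add_right htop (by simp)
      obtain ⟨c, hlt⟩ := iInf_lt_iff.1 hlt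
      obtain ⟨hc, hlt⟩ := iInf_lt_iff.1 hlt
      refine ⟨c, hc, ?_⟩
      rintro b ⟨c', hc', hb⟩
      refine hlt.le.trans ?_
      gcongr
      exact (iInf₂_le c' hc').trans hb
  choose c hc hopt using hnear
  refine ⟨fun n => (c n).1, fun n => (c n).2, hc, ?_⟩
  refine ENNReal.le_of_forall_pos_le_add fun ε hε _ => ?_
  have hε2 : 0 < ε / 2 := by positivity
  refine limsup_le_of_le (h := ?_)
  have hinv : ∀ᶠ n : ℕ in atTop, (n : ℝ≥0∞)⁻¹ < ((ε / 2 : ℝ≥0) : ℝ≥0∞) :=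
    ENNReal.tendsto_inv_nat_nhds_zero.eventually (gt_mem_nhds (by exact_mod_cast hε2))
  filter_upwards [S.eventually_exists_code hN hθ hR hε2, hinv] with n ⟨f, g, hf, hle⟩ hn
  refine (hopt n _ ⟨(f, g), hf, hle⟩).trans ?_
  calc (S.meanDistortion θ : ℝ≥0∞) + ((ε / 2 : ℝ≥0) : ℝ≥0∞) + (n : ℝ≥0∞)⁻¹
      ≤ D + ((ε / 2 : ℝ≥0) : ℝ≥0∞) + ((ε / 2 : ℝ≥0) : ℝ≥0∞) := by gcongr
    _ = D + ε := by
        rw [add_assoc, ← ENNReal.coe_add, add_halves]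

lemma condRDFunction_le_Rcond (hN : 0 < N) (D : ℝ≥0) :
    condRDFunction S.jointLaw D ≤ S.Rcond D := by
  have hN' : (0 : ℝ) < N := by exact_mod_cast hN
  have h2 : 0 < Real.log 2 := Real.log_pos one_lt_two
  refine S.le_Rcond_of_forall hN fun θ hθ hD => ENNReal.le_of_forall_pos_le_add fun ε hε _ => ?_
  have hε' : (0 : ℝ) < ε := hε
  set x : ℝ := S.meanGain θ / (N * Real.log 2) with hx
  have hx0 : 0 ≤ x := div_nonneg (S.meanGain_nonneg hθ) (by positivity)
  have hR : S.meanGain θ < N * ((x.toNNReal + ε : ℝ≥0) : ℝ) * Real.log 2 := by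
    rw [NNReal.coe_add, Real.coe_toNNReal _ hx0]
    have h3 : S.meanGain θ = N * x * Real.log 2 := by rw [hx]; field_simp
    have h4 : 0 < N * (ε : ℝ) * Real.log 2 := by positivity
    rw [h3]
    linarith
  refine iInf_le_of_le (x.toNNReal + ε) <|
    iInf_le_of_le (S.achievableWithState hN hθ hR hD) (le_of_eq ?_)
  rw [ENNReal.coe_add]
  rfl

end GaussianMixture

end CSI

end

theorem theorem2 {N K : ℕ} (hN : 0 < N) (S : CSI.GaussianMixture N K) (D : ℝ≥0) :
    -- the minimum in the definition of the benchmark is attained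
    (∃ d : Fin K → ℝ≥0, ∑ c, S.weight c * d c ≤ D ∧ S.allocationRate d = S.Rcond D) ∧
    -- with the state revealed to both terminals, the minimum required rate is the benchmark
    CSI.condRDFunction S.jointLaw D = S.Rcond D ∧
    CSI.condInfoRD S.jointLaw D = S.Rcond D ∧
    -- the rate-distortion function of the mixture is at least the benchmark
    S.Rcond D ≤ CSI.rdFunction S.law D ∧
    S.Rcond D ≤ CSI.infoRD S.law D :=
  ⟨S.exists_allocationRate_eq_Rcond hN D,
    le_antisymm (S.condRDFunction_le_Rcond hN D) (S.Rcond_le_condRDFunction hN D),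
    le_antisymm (S.condInfoRD_le_Rcond hN D) (S.Rcond_le_condInfoRD hN D),
    (S.Rcond_le_condRDFunction hN D).trans (S.condRDFunction_le_rdFunction D),
    S.Rcond_le_infoRD hN D⟩
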